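/- Let $n\ge 1$. A cube is a cube $Q\subset\mathbb R^n$ with positive side length and sides parallel to the axes; $|Q|$ is its Lebesgue measure, $f_Q=|Q|^{-1}\int_Q f$, and $\sup_Q$ runs over all cubes. A weight is a nonnegative locally integrable function that takes values in $(0,\infty)$ a.e.; for a weight $v$ put $v(Q)=\int_Q v(x)\,dx$. A weight $\mu$ is in $A_1$ if there is $C>0$ such that for every cube $Q$ one has $|Q|^{-1}\int_Q\mu(y)\,dy\le C\mu(x)$ for a.e. $x\in Q$. Functions are real-valued. For locally integrable $f$ let $$M^\sharp(f)(x)=\sup_{Q\ni x}\frac1{|Q|}\int_Q|f(y)-f_Q|\,dy,\qquad [b,M^\sharp](f)=b\,M^\sharp(f)-M^\sharp(bf).$$ For $\mu\in A_1$ and $0<\beta<1$, $Lip_{\beta,\mu}$ is the set of locally integrable $f$ with $$\sup_Q\frac1{\mu(Q)^{\beta/n}}\cdot\frac1{\mu(Q)}\int_Q|f(x)-f_Q|\,dx<\infty.$$ For $1\le p<\infty$, $0<\kappa<1$ and weights $u,v$, $L^{p,\kappa}(u,v)$ is the set of $f\in L^p_{\mathrm{loc}}(u)$ with $$\|f\|_{L^{p,\kappa}(u,v)}=\sup_Q\Big(\frac1{v(Q)^\kappa}\int_Q|f(x)|^pu(x)\,dx\Big)^{1/p}<\infty,$$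 and $L^{p,\kappa}(\mu)=L^{p,\kappa}(\mu,\mu)$. **Theorem.** Let $b$ be a locally integrable function on $\mathbb R^n$, $\mu\in A_1$ and $0<\beta<1$. Suppose that $1<p<n/\beta$, $1/q=1/p-\beta/n$ and $0<\kappa<p/q$. Then the following are equivalent: 1. $b\in Lip_{\beta,\mu}$ and $b\ge0$ a.e. in $\mathbb R^n$. 2. $[b,M^\sharp]$ is bounded from $L^{p,\kappa}(\mu)$ to $L^{q,\kappa q/p}(\mu^{1-q},\mu)$; that is, there is a constant $C$ such that for every $f\in L^{p,\kappa}(\mu)$ the functions $f$ and $bf$ are locally integrable, $M^\sharp(f)$ and $M^\sharp(bf)$ are finite a.e., $[b,M^\sharp](f)\in L^{q,\kappa q/p}(\mu^{1-q},\mu)$, and $\|[b,M^\sharp](f)\|_{L^{q,\kappa q/p}(\mu^{1-q},\mu)}\le C\|f\|_{L^{p,\kappa}(\mu)}$. 3. There is a constant $C>0$ such that $$\sup_Q\frac1{\mu(Q)^{\beta/n}}\Big(\frac1{\mu(Q)}\int_Q\big|b(x)-2M^\sharp(b\chi_Q)(x)\big|^q\mu(x)^{1-q}\,dx\Big)^{1/q}\le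 C.$$ -/

import Mathlib

open MeasureTheory
open scoped ENNReal NNReal

namespace WMorrey

/-- A (closed, nondegenerate) cube in `ℝⁿ` with sides parallel to the coordinate axes. -/
def IsCube {n : ℕ} (Q : Set (Fin n → ℝ)) : Prop :=
  ∃ (a : Fin n → ℝ) (l : ℝ), 0 < l ∧ Q = Set.Icc a (fun i => a i + l)

/-- A weight: a nonnegative locally integrable function with values in `(0,∞)` almost everywhere. -/
structure IsWeight {n : ℕ} (μ : (Fin n → ℝ) → ℝ) : Prop where
  nonneg : ∀ x, 0 ≤ μ x
  locallyIntegrable : LocallyIntegrable μ volume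
  pos_ae : ∀ᵐ x, 0 < μ x

/-- The Muckenhoupt class `A₁`. -/
def IsA1 {n : ℕ} (μ : (Fin n → ℝ) → ℝ) : Prop :=
  IsWeight μ ∧ ∃ C : ℝ, 0 < C ∧ ∀ Q : Set (Fin n → ℝ), IsCube Q →
    ∀ᵐ x ∂(volume.restrict Q), (⨍ y in Q, μ y) ≤ C * μ x

/-- `w(Q) = ∫_Q w(x) dx`. -/
noncomputable def wmass {n : ℕ} (w : (Fin n → ℝ) → ℝ) (Q : Set (Fin n → ℝ)) : ℝ≥0∞ :=
  ∫⁻ x in Q, ENNReal.ofReal (w x)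

/-- The normalized weighted `L^s` size of `g` on `Q`:
`μ(Q)^{-β/n} (μ(Q)^{-1} ∫_Q |g(x)|^s μ(x)^{1-s} dx)^{1/s}`. -/
noncomputable def normalizedSize {n : ℕ} (β s : ℝ) (μ : (Fin n → ℝ) → ℝ)
    (Q : Set (Fin n → ℝ)) (g : (Fin n → ℝ) → ℝ) : ℝ≥0∞ :=
  (1 / wmass μ Q ^ (β / n)) *
    ((1 / wmass μ Q) * ∫⁻ x in Q, ‖g x‖ₑ ^ s * ENNReal.ofReal (μ x ^ (1 - s))) ^ (1 / s)

/-- The weighted Lipschitz seminorm of `f` in `Lip^s_{β,μ}`, for `1 ≤ s < ∞`. -/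
noncomputable def lipNorm {n : ℕ} (β s : ℝ) (μ f : (Fin n → ℝ) → ℝ) : ℝ≥0∞ :=
  ⨆ (Q : Set (Fin n → ℝ)) (_ : IsCube Q),
    normalizedSize β s μ Q (fun x => f x - ⨍ y in Q, f y)

/-- `f ∈ Lip_{β,μ} = Lip^1_{β,μ}`. -/
def MemLip {n : ℕ} (β : ℝ) (μ f : (Fin n → ℝ) → ℝ) : Prop :=
  LocallyIntegrable f volume ∧ lipNorm β 1 μ f < ∞

/-- The norm of the weighted Morrey space `L^{p,κ}(u,v)`. -/
noncomputable def morreyNorm {n : ℕ} (p κ : ℝ) (u v f : (Fin n → ℝ) → ℝ) : ℝ≥0∞ :=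
  ⨆ (Q : Set (Fin n → ℝ)) (_ : IsCube Q),
    ((1 / wmass v Q ^ κ) * ∫⁻ x in Q, ‖f x‖ₑ ^ p * ENNReal.ofReal (u x)) ^ (1 / p)

/-- `f ∈ L^{p,κ}(u,v)`: `f` is measurable, lies in `L^p_loc(u)`, and has finite Morrey norm. -/
structure MemMorrey {n : ℕ} (p κ : ℝ) (u v f : (Fin n → ℝ) → ℝ) : Prop where
  aestronglyMeasurable : AEStronglyMeasurable f volume
  locally_finite : ∀ K : Set (Fin n → ℝ), IsCompact K →
    ∫⁻ x in K, ‖f x‖ₑ ^ p * ENNReal.ofReal (u x) < ∞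
  norm_lt_top : morreyNorm p κ u v f < ∞

/-- The sharp maximal function `M^♯ f(x) = sup_{Q ∋ x} |Q|⁻¹ ∫_Q |f(y) - f_Q| dy`, with values in
`[0,∞]`, for locally integrable `f`. -/
noncomputable def sharpMax {n : ℕ} (f : (Fin n → ℝ) → ℝ) (x : Fin n → ℝ) : ℝ≥0∞ :=
  ⨆ (Q : Set (Fin n → ℝ)) (_ : IsCube Q) (_ : x ∈ Q),
    ⨍⁻ y in Q, ‖f y - ⨍ z in Q, f z‖ₑ ∂volume

/-- The commutator `[b, M^♯] f = b M^♯ f - M^♯ (b f)`. It is meaningful almost everywhere when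
`SharpCommDefined b f` holds. -/
noncomputable def sharpComm {n : ℕ} (b f : (Fin n → ℝ) → ℝ) (x : Fin n → ℝ) : ℝ :=
  b x * (sharpMax f x).toReal - (sharpMax (fun y => b y * f y) x).toReal

/-- `[b, M^♯] f` is well defined almost everywhere: both sharp maximal functions are taken of
locally integrable functions and are finite almost everywhere, so that the difference makes sense. -/
structure SharpCommDefined {n : ℕ} (b f : (Fin n → ℝ) → ℝ) : Prop where
  locallyIntegrable : LocallyIntegrable f volume
  locallyIntegrable_mul : LocallyIntegrable (fun y => b y * f y) volume
  finite_ae : ∀ᵐ x, sharpMax f x < ∞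
  finite_mul_ae : ∀ᵐ x, sharpMax (fun y => b y * f y) x < ∞

/-- `[b, M^♯]` is bounded from `L^{p,κ}(u₁,v₁)` to `L^{q,l}(u₂,v₂)`: it is defined on the whole first
space, maps it into the second, and satisfies a norm inequality with a uniform constant. -/
def SharpCommBounded {n : ℕ} (b : (Fin n → ℝ) → ℝ) (p κ : ℝ) (u₁ v₁ : (Fin n → ℝ) → ℝ)
    (q l : ℝ) (u₂ v₂ : (Fin n → ℝ) → ℝ) : Prop :=
  ∃ C : ℝ≥0, ∀ f : (Fin n → ℝ) → ℝ, MemMorrey p κ u₁ v₁ f →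
    SharpCommDefined b f ∧ MemMorrey q l u₂ v₂ (sharpComm b f) ∧
      morreyNorm q l u₂ v₂ (sharpComm b f) ≤ C * morreyNorm p κ u₁ v₁ f

end WMorrey

open Metric Filter Topology

namespace WMorrey

section

variable {n : ℕ} {μ : (Fin n → ℝ) → ℝ} {C : ℝ≥0}

/-! ### Cubes as closed balls -/

/-! Cubes are closed balls of the sup norm, so covering and differentiation theorems for balls apply
to them.

For 1 ⇒ 2, the averages of `b` are telescoped along cubes shrinking to `x`. The `A₁` condition turns
the Lipschitz condition into a bound for each step, and reverse doubling makes the steps decay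
geometrically, so `|b(x) - b_Q| ≤ K μ(x) μ(Q)^{β/n}` (`exists_lip_pointwise`). Since `b ≥ 0`, `b(x)
M^♯ f(x)` is the sharp maximal function at `x` of `f` multiplied by the frozen number `b(x)`. Hence
the commutator at `x` is at most a constant times the supremum of the averages of `|b(y) -
b(x)||f(y)|`, which is at most a constant times `μ(x)` times the fractional maximal function of `f`
for the measure `μ dx`. The factor `μ(x)^q` meets the target weight `μ^{1-q}` and leaves `μ`, so
what remains is the Morrey estimate `exists_fracMax_morrey`. A Hedberg-type interpolation reduces it
to a maximal function raised to a power below one, for which the weak type inequality suffices.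

For 2 ⇒ 3, the test function is `χ_Q`, because `M^♯ χ_Q = 1/2` on `Q`.

For 3 ⇒ 1, comparison with a concentric cube of twice the volume gives `|b_Q| ≤ 2 M^♯(bχ_Q)` on `Q`.
Thus `g = b - 2 M^♯(bχ_Q)` satisfies `|b_Q| ≤ b - g` there, and the mean of `|g|` controls both the
oscillation of `b` and `|b_Q| - b_Q`. Hölder's inequality bounds that mean by the quantity in 3, and
Lebesgue differentiation then yields `b ≥ 0`. -/

lemma isCube_iff {Q : Set (Fin n → ℝ)} :
    IsCube Q ↔ ∃ (c : Fin n → ℝ) (r : ℝ), 0 < r ∧ Q = closedBall c r := by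
  constructor
  · rintro ⟨a, l, hl, rfl⟩
    refine ⟨fun i => a i + l / 2, l / 2, by positivity, ?_⟩
    rw [closedBall_pi _ (by positivity), ← Set.pi_univ_Icc]
    congr 1
    ext1 i
    rw [Real.closedBall_eq_Icc]
    congr 1 <;> ring
  · rintro ⟨c, r, hr, rfl⟩
    refine ⟨fun i => c i - r, 2 * r, by positivity, ?_⟩
    rw [closedBall_pi _ hr.le, ← Set.pi_univ_Icc]
    congr 1
    ext1 i
    rw [Real.closedBall_eq_Icc]
    congr 1
    ring

lemma isCube_closedBall (c : Fin n → ℝ) {r : ℝ} (hr : 0 < r) : IsCube (closedBall c r) :=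
  isCube_iff.2 ⟨c, r, hr, rfl⟩

lemma volume_closedBall_pos (c : Fin n → ℝ) {r : ℝ} (hr : 0 < r) :
    0 < volume (closedBall c r) :=
  measure_closedBall_pos _ _ hr

lemma volume_closedBall_lt_top (c : Fin n → ℝ) (r : ℝ) : volume (closedBall c r) < ∞ :=
  measure_closedBall_lt_top

lemma volume_closedBall_scale (c c' : Fin n → ℝ) {K r : ℝ} (hK : 0 ≤ K) (hr : 0 ≤ r) :
    volume (closedBall c' (K * r)) = ENNReal.ofReal (K ^ n) * volume (closedBall c r) := by
  rw [Real.volume_pi_closedBall _ (by positivity), Real.volume_pi_closedBall _ hr,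
    ← ENNReal.ofReal_mul (by positivity), Fintype.card_fin]
  congr 1
  ring

/-! ### The weighted measure -/

/-- The weight as an extended nonnegative function. -/
noncomputable def wt (μ : (Fin n → ℝ) → ℝ) (x : Fin n → ℝ) : ℝ≥0∞ := ENNReal.ofReal (μ x)

/-- The measure `μ(x) dx`. -/
noncomputable def wMeasure (μ : (Fin n → ℝ) → ℝ) : Measure (Fin n → ℝ) :=
  volume.withDensity (wt μ)

lemma wmass_eq (Q : Set (Fin n → ℝ)) : wmass μ Q = wMeasure μ Q :=
  (withDensity_apply' _ _).symm

lemma wMeasure_apply (Q : Set (Fin n → ℝ)) : wMeasure μ Q = ∫⁻ x in Q, wt μ x :=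
  withDensity_apply' _ _

lemma IsWeight.aemeasurable_wt (h : IsWeight μ) : AEMeasurable (wt μ) volume :=
  h.locallyIntegrable.aestronglyMeasurable.aemeasurable.ennreal_ofReal

lemma IsWeight.wt_pos (h : IsWeight μ) : ∀ᵐ x, 0 < wt μ x := by
  filter_upwards [h.pos_ae] with x hx
  exact ENNReal.ofReal_pos.2 hx

lemma wt_lt_top (x : Fin n → ℝ) : wt μ x < ∞ := ENNReal.ofReal_lt_top

lemma wMeasure_absolutelyContinuous : wMeasure μ ≪ volume :=
  withDensity_absolutelyContinuous _ _

lemma IsWeight.absolutelyContinuous_wMeasure (h : IsWeight μ) :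
    (volume : Measure (Fin n → ℝ)) ≪ wMeasure μ :=
  withDensity_absolutelyContinuous' h.aemeasurable_wt (h.wt_pos.mono fun _ hx => hx.ne')

lemma IsWeight.setLIntegral_wMeasure (h : IsWeight μ) (g : (Fin n → ℝ) → ℝ≥0∞)
    (Q : Set (Fin n → ℝ)) : ∫⁻ x in Q, g x ∂(wMeasure μ) = ∫⁻ x in Q, g x * wt μ x := by
  rw [wMeasure, setLIntegral_withDensity_eq_setLIntegral_mul_non_measurable₀' _ _
    h.aemeasurable_wt.restrict _ (Eventually.of_forall fun x => wt_lt_top x)]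
  exact lintegral_congr fun x => mul_comm _ _

lemma IsWeight.wMeasure_lt_top (h : IsWeight μ) {K : Set (Fin n → ℝ)} (hK : IsCompact K) :
    wMeasure μ K < ∞ := by
  rw [wMeasure_apply]
  have h1 := (h.locallyIntegrable.integrableOn_isCompact hK).hasFiniteIntegral
  refine lt_of_le_of_lt (lintegral_mono fun x => ?_) h1
  rw [wt, ← Real.enorm_of_nonneg (h.nonneg x)]

lemma IsWeight.wMeasure_closedBall_lt_top (h : IsWeight μ) (c : Fin n → ℝ) (r : ℝ) :
    wMeasure μ (closedBall c r) < ∞ :=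
  h.wMeasure_lt_top (isCompact_closedBall c r)

lemma IsWeight.wMeasure_closedBall_pos (h : IsWeight μ) (c : Fin n → ℝ) {r : ℝ} (hr : 0 < r) :
    0 < wMeasure μ (closedBall c r) := by
  rw [pos_iff_ne_zero]
  intro h0
  exact (volume_closedBall_pos c hr).ne' (h.absolutelyContinuous_wMeasure h0)

/-- The `A₁` condition with all cubes handled simultaneously, in terms of closed balls. -/
def A1Bound (μ : (Fin n → ℝ) → ℝ) (C : ℝ≥0) : Prop :=
  ∀ᵐ x, ∀ (c : Fin n → ℝ) (r : ℝ), 0 < r → x ∈ closedBall c r →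
    wMeasure μ (closedBall c r) ≤ C * wt μ x * volume (closedBall c r)

/-- The exceptional null set in `A₁` depends on the cube. Countably many cubes, with centres in a
dense sequence and rational radii, share one null set; every cube lies in one of them of less than
twice the radius, at the cost of a factor `2 ^ n`. -/
lemma IsA1.exists_bound (h : IsA1 μ) : ∃ C : ℝ≥0, 0 < C ∧ A1Bound μ C := by
  obtain ⟨hw, C, hC, hA⟩ := h
  have key : ∀ (c : Fin n → ℝ) (r : ℝ), 0 < r → ∀ᵐ x, x ∈ closedBall c r →
      wMeasure μ (closedBall c r) ≤ ENNReal.ofReal C * wt μ x * volume (closedBall c r) := by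
    intro c r hr
    have h1 := hA _ (isCube_closedBall c hr)
    rw [ae_restrict_iff' measurableSet_closedBall] at h1
    filter_upwards [h1] with x hx hxQ
    have h2 := hx hxQ
    have hv : 0 < (volume (closedBall c r)).toReal :=
      ENNReal.toReal_pos (volume_closedBall_pos c hr).ne' (volume_closedBall_lt_top c r).ne
    rw [setAverage_eq, smul_eq_mul, measureReal_def, inv_mul_le_iff₀ hv] at h2
    have hint : IntegrableOn μ (closedBall c r) :=
      hw.locallyIntegrable.integrableOn_isCompact (isCompact_closedBall c r)
    rw [wMeasure_apply]
    simp only [wt]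
    rw [← ofReal_integral_eq_lintegral_ofReal hint (Eventually.of_forall hw.nonneg)]
    refine (ENNReal.ofReal_le_ofReal h2).trans (le_of_eq ?_)
    rw [ENNReal.ofReal_mul hv.le, ENNReal.ofReal_mul hC.le,
      ENNReal.ofReal_toReal (volume_closedBall_lt_top c r).ne]
    ring
  have key2 : ∀ᵐ x, ∀ (k : ℕ) (ρ : ℚ), 0 < (ρ : ℝ) →
      x ∈ closedBall (TopologicalSpace.denseSeq (Fin n → ℝ) k) (ρ : ℝ) →
      wMeasure μ (closedBall (TopologicalSpace.denseSeq (Fin n → ℝ) k) (ρ : ℝ)) ≤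
        ENNReal.ofReal C * wt μ x *
          volume (closedBall (TopologicalSpace.denseSeq (Fin n → ℝ) k) (ρ : ℝ)) := by
    rw [ae_all_iff]; intro k
    rw [ae_all_iff]; intro ρ
    by_cases hρ : 0 < (ρ : ℝ)
    · filter_upwards [key (TopologicalSpace.denseSeq (Fin n → ℝ) k) ρ hρ] with x hx _ using hx
    · exact Eventually.of_forall fun x h => absurd h hρ
  refine ⟨Real.toNNReal (C * 2 ^ n), Real.toNNReal_pos.2 (by positivity), ?_⟩
  filter_upwards [key2] with x hx c r hr hxc
  obtain ⟨k, hk⟩ := (TopologicalSpace.denseRange_denseSeq (Fin n → ℝ)).exists_dist_lt c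
    (half_pos hr)
  -- The new centre is within `r / 2` of `c`, so a radius above `3r/2` ensures inclusion; staying
  -- below `2r` controls the volume.
  obtain ⟨ρ, hρ1, hρ2⟩ := exists_rat_btwn (show 3 / 2 * r < 2 * r by linarith)
  set d := TopologicalSpace.denseSeq (Fin n → ℝ) k
  have hsub : closedBall c r ⊆ closedBall d ρ := closedBall_subset_closedBall' (by linarith)
  calc wMeasure μ (closedBall c r) ≤ wMeasure μ (closedBall d ρ) := measure_mono hsub
    _ ≤ ENNReal.ofReal C * wt μ x * volume (closedBall d ρ) :=
        hx k ρ (by linarith) (hsub hxc)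
    _ ≤ ENNReal.ofReal C * wt μ x * volume (closedBall d (2 * r)) := by
        gcongr
    _ = _ := by
        rw [volume_closedBall_scale c d (by norm_num) hr.le, ← ENNReal.ofReal,
          ENNReal.ofReal_mul hC.le]
        ring

/-- Comparison of `μ`-proportions with Lebesgue proportions. -/
lemma A1Bound.mul_volume_le (hA : A1Bound μ C) {c : Fin n → ℝ} {r : ℝ} (hr : 0 < r)
    {E : Set (Fin n → ℝ)} (hE : MeasurableSet E) (hEs : E ⊆ closedBall c r) :
    wMeasure μ (closedBall c r) * volume E ≤
      C * volume (closedBall c r) * wMeasure μ E := by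
  have hfin : (C : ℝ≥0∞) * volume (closedBall c r) ≠ ∞ :=
    ENNReal.mul_ne_top ENNReal.coe_ne_top (volume_closedBall_lt_top c r).ne
  rw [wMeasure_apply E, ← lintegral_const_mul' _ _ hfin, ← setLIntegral_const]
  refine setLIntegral_mono_ae' hE ?_
  filter_upwards [hA] with x hx hxE
  refine (hx c r hr (hEs hxE)).trans (le_of_eq ?_)
  ring

lemma A1Bound.doubling (hA : A1Bound μ C) {c c' : Fin n → ℝ} {r K : ℝ} (hr : 0 < r)
    (hK : 0 < K) (hs : closedBall c r ⊆ closedBall c' (K * r)) :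
    wMeasure μ (closedBall c' (K * r)) ≤
      C * ENNReal.ofReal (K ^ n) * wMeasure μ (closedBall c r) := by
  have h := hA.mul_volume_le (by positivity) measurableSet_closedBall hs
  rw [volume_closedBall_scale c c' hK.le hr.le] at h
  rw [← ENNReal.mul_le_mul_iff_left (volume_closedBall_pos c hr).ne'
    (volume_closedBall_lt_top c r).ne]
  refine h.trans (le_of_eq ?_)
  ring

/-- The complement of the half-size cube has at least half of the volume since `n ≥ 1`, so by `A₁`
it carries at least the fraction `1 / (2C)` of the weighted mass. -/
lemma A1Bound.reverse_doubling (hw : IsWeight μ) (hA : A1Bound μ C) (hC : 0 < C) (hn : 1 ≤ n) :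
    ∃ δ : ℝ≥0∞, δ < 1 ∧ ∀ (c c' : Fin n → ℝ) (r : ℝ), 0 < r →
      closedBall c' (r / 2) ⊆ closedBall c r →
      wMeasure μ (closedBall c' (r / 2)) ≤ δ * wMeasure μ (closedBall c r) := by
  have hC' : (0 : ℝ) < C := hC
  refine ⟨ENNReal.ofReal (1 - 1 / (2 * C)), ?_, ?_⟩
  · rw [ENNReal.ofReal_lt_one]
    have : (0 : ℝ) < 1 / (2 * C) := by positivity
    linarith
  intro c c' r hr hs
  have hfB := (hw.wMeasure_closedBall_lt_top c r).ne
  have hfB' := (hw.wMeasure_closedBall_lt_top c' (r / 2)).ne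
  have h := hA.mul_volume_le hr (measurableSet_closedBall.diff measurableSet_closedBall)
    (E := closedBall c r \ closedBall c' (r / 2)) Set.sdiff_subset
  rw [measure_sdiff hs measurableSet_closedBall.nullMeasurableSet hfB',
    measure_sdiff hs measurableSet_closedBall.nullMeasurableSet
      (volume_closedBall_lt_top c' (r / 2)).ne] at h
  have hv' : volume (closedBall c' (r / 2)) ≤ ENNReal.ofReal (1 / 2) * volume (closedBall c r) := by
    rw [show r / 2 = (1 / 2) * r by ring, volume_closedBall_scale c c' (by norm_num) hr.le]
    gcongr
    calc ((1 : ℝ) / 2) ^ n ≤ (1 / 2) ^ 1 :=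
          pow_le_pow_of_le_one (by norm_num) (by norm_num) hn
      _ = 1 / 2 := by norm_num
  have hle : wMeasure μ (closedBall c' (r / 2)) ≤ wMeasure μ (closedBall c r) := measure_mono hs
  have hvle : volume (closedBall c' (r / 2)) ≤ volume (closedBall c r) := measure_mono hs
  have hvB := (volume_closedBall_lt_top c r).ne
  have hvpos : 0 < (volume (closedBall c r)).toReal :=
    ENNReal.toReal_pos (volume_closedBall_pos c hr).ne' hvB
  have h2 := ENNReal.toReal_mono (by finiteness) h
  have h3 := ENNReal.toReal_mono (by finiteness) hv'
  simp only [ENNReal.toReal_mul, ENNReal.toReal_sub_of_le hle hfB,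
    ENNReal.toReal_sub_of_le hvle hvB, ENNReal.coe_toReal] at h2
  rw [ENNReal.toReal_mul, ENNReal.toReal_ofReal (by norm_num)] at h3
  set m := (wMeasure μ (closedBall c r)).toReal
  set m' := (wMeasure μ (closedBall c' (r / 2))).toReal
  set v := (volume (closedBall c r)).toReal
  set v' := (volume (closedBall c' (r / 2))).toReal
  have hm : 0 ≤ m := ENNReal.toReal_nonneg
  have h4 : v * (m / 2) ≤ v * (C * (m - m')) := by nlinarith
  have h5 := le_of_mul_le_mul_left h4 hvpos
  rw [← ENNReal.ofReal_toReal hfB, ← ENNReal.ofReal_toReal hfB', ← ENNReal.ofReal_mul' hm]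
  apply ENNReal.ofReal_le_ofReal
  change m' ≤ (1 - 1 / (2 * C)) * m
  have h6 : (1 - 1 / (2 * (C : ℝ))) * m = m - m / 2 / C := by field_simp
  rw [h6]
  have : m / 2 / C ≤ m - m' := by
    rw [div_le_iff₀ hC']; linarith
  linarith

end

section

variable {n : ℕ}

/-! ### A local maximal function and its weak type estimate -/

/-- The noncentred maximal function over balls of radius at most `ρ`. -/
noncomputable def locMax (ν : Measure (Fin n → ℝ)) (ρ : ℝ) (F : (Fin n → ℝ) → ℝ≥0∞)
    (x : Fin n → ℝ) : ℝ≥0∞ :=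
  ⨆ (c : Fin n → ℝ) (r : ℝ) (_ : 0 < r ∧ r ≤ ρ ∧ x ∈ closedBall c r),
    (ν (closedBall c r))⁻¹ * ∫⁻ y in closedBall c r, F y ∂ν

lemma le_locMax {ν : Measure (Fin n → ℝ)} {ρ : ℝ} {F : (Fin n → ℝ) → ℝ≥0∞} {x c : Fin n → ℝ}
    {r : ℝ} (hr : 0 < r) (hρ : r ≤ ρ) (hx : x ∈ closedBall c r) :
    (ν (closedBall c r))⁻¹ * ∫⁻ y in closedBall c r, F y ∂ν ≤ locMax ν ρ F x :=
  le_iSup_of_le c (le_iSup₂_of_le r ⟨hr, hρ, hx⟩ le_rfl)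

/-- Vitali covering: balls witnessing `t < locMax` have a disjoint subfamily whose fourfold
enlargements cover the set. The selected balls meet `closedBall z R` and have radius at most `ρ`,
hence the domain of radius `R + 2ρ`. Only outer measure is used on the level set, so no
measurability of `F` is needed. -/
lemma weak_type_locMax {ν : Measure (Fin n → ℝ)} {D : ℝ≥0∞}
    (hD : ∀ (c : Fin n → ℝ) (r : ℝ), 0 < r →
      ν (closedBall c (4 * r)) ≤ D * ν (closedBall c r))
    (hpos : ∀ (c : Fin n → ℝ) (r : ℝ), 0 < r → 0 < ν (closedBall c r))
    (hfin : ∀ (c : Fin n → ℝ) (r : ℝ), ν (closedBall c r) < ∞)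
    (F : (Fin n → ℝ) → ℝ≥0∞) (z : Fin n → ℝ) (R ρ : ℝ) (t : ℝ≥0∞) :
    t * ν (closedBall z R ∩ {x | t < locMax ν ρ F x}) ≤
      D * ∫⁻ x in closedBall z (R + 2 * ρ), F x ∂ν := by
  set S := closedBall z R ∩ {x | t < locMax ν ρ F x} with hS
  have hex : ∀ x ∈ S, ∃ B : (Fin n → ℝ) × ℝ, 0 < B.2 ∧ B.2 ≤ ρ ∧ x ∈ closedBall B.1 B.2 ∧
      t < (ν (closedBall B.1 B.2))⁻¹ * ∫⁻ y in closedBall B.1 B.2, F y ∂ν := by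
    rintro x ⟨-, hx⟩
    simp only [locMax, Set.mem_ofPred_eq, lt_iSup_iff] at hx
    obtain ⟨c, r, ⟨h1, h2, h3⟩, h4⟩ := hx
    exact ⟨(c, r), h1, h2, h3, h4⟩
  choose! B hB0 hBρ hBm hBt using hex
  obtain ⟨u, huS, hdisj, hcov⟩ := Vitali.exists_disjoint_subfamily_covering_enlargement_closedBall
    S (fun x => (B x).1) (fun x => (B x).2) ρ hBρ 4 (by norm_num)
  have hu : u.Countable := hdisj.countable_of_nonempty_interior fun x hx =>
    ⟨(B x).1, ball_subset_interior_closedBall (mem_ball_self (hB0 x (huS hx)))⟩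
  have hsub : S ⊆ ⋃ x ∈ u, closedBall (B x).1 (4 * (B x).2) := by
    intro x hx
    obtain ⟨y, hy, hxy⟩ := hcov x hx
    exact Set.mem_biUnion hy (hxy (hBm x hx))
  have hball : ∀ x ∈ u, t * ν (closedBall (B x).1 (B x).2) ≤
      ∫⁻ y in closedBall (B x).1 (B x).2, F y ∂ν := by
    intro x hx
    have h1 := hBt x (huS hx)
    have h2 := (hpos (B x).1 (B x).2 (hB0 x (huS hx))).ne'
    have h3 := (hfin (B x).1 (B x).2).ne
    calc t * ν (closedBall (B x).1 (B x).2)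
        ≤ ((ν (closedBall (B x).1 (B x).2))⁻¹ * ∫⁻ y in closedBall (B x).1 (B x).2, F y ∂ν)
            * ν (closedBall (B x).1 (B x).2) := by gcongr
      _ = ((ν (closedBall (B x).1 (B x).2))⁻¹ * ν (closedBall (B x).1 (B x).2)) *
            ∫⁻ y in closedBall (B x).1 (B x).2, F y ∂ν := by ring
      _ = _ := by rw [ENNReal.inv_mul_cancel h2 h3, one_mul]
  have := hu.to_subtype
  calc t * ν S ≤ t * ∑' x : u, ν (closedBall (B x).1 (4 * (B x).2)) := by
        gcongr
        exact (measure_mono hsub).trans (measure_biUnion_le _ hu _)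
    _ ≤ t * ∑' x : u, D * ν (closedBall (B x).1 (B x).2) := by
        gcongr with x
        exact hD _ _ (hB0 x (huS x.2))
    _ = D * ∑' x : u, t * ν (closedBall (B x).1 (B x).2) := by
        rw [ENNReal.tsum_mul_left, ENNReal.tsum_mul_left]; ring
    _ ≤ D * ∑' x : u, ∫⁻ y in closedBall (B x).1 (B x).2, F y ∂ν := by
        gcongr with x
        exact hball x x.2
    _ = D * ∫⁻ y in ⋃ x ∈ u, closedBall (B x).1 (B x).2, F y ∂ν := by
        rw [lintegral_biUnion hu (fun _ _ => measurableSet_closedBall) hdisj]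
    _ ≤ _ := by
        gcongr
        refine Set.iUnion₂_subset fun x hx => closedBall_subset_closedBall' ?_
        have h1 := mem_closedBall.1 (hBm x (huS hx))
        have h2 := mem_closedBall.1 (huS hx).1
        have h3 := hBρ x (huS hx)
        have h4 := dist_triangle_left (B x).1 z x
        linarith

lemma measure_inter_eq_top_eq_zero {α : Type*} [MeasurableSpace α] {ν : Measure α} {S : Set α}
    {A : α → ℝ≥0∞} {M : ℝ≥0∞} (hM : M ≠ ∞)
    (h : ∀ t : ℝ≥0∞, t ≠ ∞ → t * ν (S ∩ {x | t < A x}) ≤ M) :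
    ν (S ∩ {x | A x = ∞}) = 0 := by
  by_contra h0
  obtain ⟨m, hm⟩ := ENNReal.exists_nat_mul_gt h0 hM
  refine absurd hm (not_lt.2 (le_trans ?_ (h m (ENNReal.natCast_ne_top m))))
  gcongr with x
  rintro hA
  rw [hA]
  exact ENNReal.natCast_lt_top m

/-- Kolmogorov's inequality: a weak type `(1,1)` bound controls the integral of `A ^ s`, `s < 1`. -/
lemma exists_setLIntegral_rpow_le {s : ℝ} (hs0 : 0 < s) (hs1 : s < 1) {D : ℝ≥0∞} (hD : D ≠ ∞) :
    ∃ C : ℝ≥0∞, C ≠ ∞ ∧ ∀ {α : Type} [MeasurableSpace α] (ν : Measure α) (S : Set α)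
      (A : α → ℝ≥0∞) (T : ℝ≥0∞), MeasurableSet S → ν S ≠ ∞ → T ≠ 0 → T ≠ ∞ →
      (∀ t : ℝ≥0∞, t ≠ ∞ → t * ν (S ∩ {x | t < A x}) ≤ D * T * ν S) →
      ∫⁻ x in S, A x ^ s ∂ν ≤ C * T ^ s * ν S := by
  have hlt : (2 : ℝ≥0∞) ^ (s - 1) < 1 :=
    ENNReal.rpow_lt_one_of_one_lt_of_neg (by norm_num) (by linarith)
  -- The `1` comes from the region `A ≤ T`; the rest sums the layers `2^k T < A ≤ 2^(k+1) T`, a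
  -- geometric series of ratio `2^(s-1) < 1`.
  refine ⟨1 + D * 2 ^ s * (1 - 2 ^ (s - 1))⁻¹, ?_, ?_⟩
  · have h1 : (1 - (2 : ℝ≥0∞) ^ (s - 1))⁻¹ ≠ ∞ := ENNReal.inv_ne_top.2 (tsub_pos_of_lt hlt).ne'
    have h2 : (2 : ℝ≥0∞) ^ s ≠ ∞ := ENNReal.rpow_ne_top_of_nonneg hs0.le (by norm_num)
    finiteness
  intro α _ ν S A T hS hνS hT0 hT h
  -- `A` is not assumed measurable, so its level sets are replaced by measurable hulls of the same
  -- measure.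
  set E : ℕ → Set α := fun k => toMeasurable ν (S ∩ {x | 2 ^ k * T < A x}) with hE
  have htop : ν (S ∩ {x | A x = ∞}) = 0 :=
    measure_inter_eq_top_eq_zero (by finiteness) h
  have hpt : ∀ᵐ x ∂(ν.restrict S), A x ^ s ≤
      T ^ s + ∑' k : ℕ, (E k).indicator (fun _ => (2 ^ (k + 1) * T) ^ s) x := by
    rw [ae_restrict_iff' hS]
    have h1 : ∀ᵐ x ∂ν, x ∉ S ∩ {x | A x = ∞} := measure_eq_zero_iff_ae_notMem.1 htop
    filter_upwards [h1] with x hx hxS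
    have hA : A x ≠ ∞ := fun h => hx ⟨hxS, h⟩
    by_cases hle : A x ≤ T
    · exact (ENNReal.rpow_le_rpow hle hs0.le).trans le_self_add
    have hex : ∃ k : ℕ, A x ≤ 2 ^ k * T := by
      obtain ⟨k, hk⟩ := ENNReal.exists_nat_mul_gt hT0 hA
      refine ⟨k, hk.le.trans ?_⟩
      gcongr
      exact_mod_cast Nat.lt_two_pow_self.le
    obtain ⟨j, hj⟩ : ∃ j, Nat.find hex = j + 1 := by
      refine Nat.exists_eq_succ_of_ne_zero fun h0 => hle ?_
      have := Nat.find_spec hex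
      rw [h0] at this
      simpa using this
    have h2 : A x ≤ 2 ^ (j + 1) * T := hj ▸ Nat.find_spec hex
    have h3 : 2 ^ j * T < A x := not_le.1 (Nat.find_min hex (by omega))
    have hxE : x ∈ E j := subset_toMeasurable _ _ ⟨hxS, h3⟩
    calc A x ^ s ≤ (2 ^ (j + 1) * T) ^ s := ENNReal.rpow_le_rpow h2 hs0.le
      _ = (E j).indicator (fun _ => (2 ^ (j + 1) * T) ^ s) x := by
          rw [Set.indicator_of_mem hxE]
      _ ≤ ∑' k : ℕ, (E k).indicator (fun _ => (2 ^ (k + 1) * T) ^ s) x :=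
          ENNReal.le_tsum (f := fun k => (E k).indicator (fun _ => (2 ^ (k + 1) * T) ^ s) x) j
      _ ≤ _ := le_add_self
  have hterm : ∀ k : ℕ, (2 ^ (k + 1) * T) ^ s * ν (E k) ≤
      D * 2 ^ s * T ^ s * ν S * (2 ^ (s - 1)) ^ k := by
    intro k
    have h1 := h (2 ^ k * T) (by finiteness)
    rw [hE, measure_toMeasurable]
    set m := ν (S ∩ {x | 2 ^ k * T < A x})
    have h2 : 2 ^ k * m ≤ D * ν S := by
      rw [← ENNReal.mul_le_mul_iff_left hT0 hT]
      calc 2 ^ k * m * T = 2 ^ k * T * m := by ring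
        _ ≤ _ := h1
        _ = _ := by ring
    have h20 : (2 : ℝ≥0∞) ^ k ≠ 0 := by positivity
    have h2t : (2 : ℝ≥0∞) ^ k ≠ ∞ := by finiteness
    have h3 : ((2 : ℝ≥0∞) ^ (s - 1)) ^ k * 2 ^ k = (2 ^ k) ^ s := by
      rw [← ENNReal.rpow_natCast (2 ^ (s - 1)), ← ENNReal.rpow_natCast 2, ← ENNReal.rpow_mul,
        ← ENNReal.rpow_mul, ← ENNReal.rpow_add _ _ (by norm_num) (by norm_num)]
      congr 1
      ring
    calc (2 ^ (k + 1) * T) ^ s * m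
        = (2 ^ s * T ^ s * (2 ^ (s - 1)) ^ k) * (2 ^ k * m) := by
          rw [pow_succ, ENNReal.mul_rpow_of_nonneg _ _ hs0.le, ENNReal.mul_rpow_of_nonneg _ _ hs0.le,
            ← h3]
          ring
      _ ≤ (2 ^ s * T ^ s * (2 ^ (s - 1)) ^ k) * (D * ν S) := by gcongr
      _ = _ := by ring
  have hEm : ∀ k, MeasurableSet (E k) := fun k => measurableSet_toMeasurable _ _
  calc ∫⁻ x in S, A x ^ s ∂ν
      ≤ ∫⁻ x in S, (T ^ s + ∑' k : ℕ, (E k).indicator (fun _ => (2 ^ (k + 1) * T) ^ s) x) ∂ν :=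
        lintegral_mono_ae hpt
    _ = T ^ s * ν S + ∑' k : ℕ, ∫⁻ x in S, (E k).indicator (fun _ => (2 ^ (k + 1) * T) ^ s) x ∂ν := by
        rw [lintegral_add_left measurable_const, setLIntegral_const,
          lintegral_tsum fun k => (measurable_const.indicator (hEm k)).aemeasurable]
    _ ≤ T ^ s * ν S + ∑' k : ℕ, D * 2 ^ s * T ^ s * ν S * (2 ^ (s - 1)) ^ k := by
        gcongr with k
        refine le_trans ?_ (hterm k)
        rw [lintegral_indicator_const (hEm k)]
        gcongr
        exact Measure.restrict_le_self
    _ = _ := by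
        rw [ENNReal.tsum_mul_left, ENNReal.tsum_geometric]
        ring

end

section

variable {n : ℕ}

/-! ### Mean oscillation with respect to a probability measure -/

section Oscillation

variable {α : Type*} [MeasurableSpace α] {P : Measure α}

/-- The mean oscillation of `f` with respect to `P`. -/
noncomputable def meanOsc (P : Measure α) (f : α → ℝ) : ℝ≥0∞ := ∫⁻ y, ‖f y - ∫ z, f z ∂P‖ₑ ∂P

/-- The difference `g - h` is paid for twice: once in the functions and once in their means. -/
lemma meanOsc_le_add [IsProbabilityMeasure P] {g h : α → ℝ} (hg : Integrable g P)
    (hh : Integrable h P) : meanOsc P g ≤ meanOsc P h + 2 * ∫⁻ y, ‖g y - h y‖ₑ ∂P := by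
  have hgh : AEMeasurable (fun y => ‖g y - h y‖ₑ) P :=
    (hg.aestronglyMeasurable.sub hh.aestronglyMeasurable).enorm
  have hm : ‖∫ z, h z ∂P - ∫ z, g z ∂P‖ₑ ≤ ∫⁻ y, ‖g y - h y‖ₑ ∂P := by
    rw [← integral_sub hh hg]
    refine (enorm_integral_le_lintegral_enorm _).trans (lintegral_mono fun y => ?_)
    rw [← enorm_neg, neg_sub]
  calc meanOsc P g
      ≤ ∫⁻ y, (‖h y - ∫ z, h z ∂P‖ₑ + (‖g y - h y‖ₑ + ‖∫ z, h z ∂P - ∫ z, g z ∂P‖ₑ)) ∂P := by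
        refine lintegral_mono fun y => ?_
        calc ‖g y - ∫ z, g z ∂P‖ₑ
            = ‖(h y - ∫ z, h z ∂P) + ((g y - h y) + (∫ z, h z ∂P - ∫ z, g z ∂P))‖ₑ := by
              congr 1; ring
          _ ≤ _ := (enorm_add_le _ _).trans (by gcongr; exact enorm_add_le _ _)
    _ = meanOsc P h + (∫⁻ y, ‖g y - h y‖ₑ ∂P + ‖∫ z, h z ∂P - ∫ z, g z ∂P‖ₑ) := by
        have hhm : AEMeasurable (fun y => ‖h y - ∫ z, h z ∂P‖ₑ) P :=
          (hh.aestronglyMeasurable.sub aestronglyMeasurable_const).enorm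
        rw [lintegral_add_left' hhm, lintegral_add_left' hgh, lintegral_const, measure_univ, mul_one]
        rfl
    _ ≤ meanOsc P h + (∫⁻ y, ‖g y - h y‖ₑ ∂P + ∫⁻ y, ‖g y - h y‖ₑ ∂P) := by gcongr
    _ = _ := by rw [two_mul]

lemma meanOsc_le_two_mul [IsProbabilityMeasure P] {g : α → ℝ} (hg : Integrable g P) :
    meanOsc P g ≤ 2 * ∫⁻ y, ‖g y‖ₑ ∂P := by
  have h := meanOsc_le_add hg (integrable_zero α ℝ P)
  simpa [meanOsc] using h

lemma meanOsc_const_mul (a : ℝ) (f : α → ℝ) :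
    meanOsc P (fun y => a * f y) = ‖a‖ₑ * meanOsc P f := by
  rw [meanOsc, meanOsc, integral_const_mul, ← lintegral_const_mul' _ _ enorm_ne_top]
  refine lintegral_congr fun y => ?_
  rw [← enorm_mul, mul_sub]

/-- Pair `g - m` with the sign that is `1` on `B` and `-1` off `B`. This sign has mean zero because
`B` has probability one half, and `g` vanishes off `B`, so the pairing returns exactly the mean `m`.
-/
lemma enorm_integral_le_meanOsc [IsProbabilityMeasure P] {B : Set α} (hB : MeasurableSet B)
    (hPB : P.real B = 1 / 2) {g : α → ℝ} (hg : Integrable g P) (hgB : ∀ x ∉ B, g x = 0) :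
    ‖∫ z, g z ∂P‖ₑ ≤ meanOsc P g := by
  set m := ∫ z, g z ∂P with hm
  set s : α → ℝ := fun x => 2 * B.indicator 1 x - 1 with hs
  have hi : Integrable (B.indicator (1 : α → ℝ)) P := (integrable_const 1).indicator hB
  have hint : ∫ x, B.indicator (1 : α → ℝ) x ∂P = 1 / 2 := by
    rw [integral_indicator_one hB, hPB]
  have hsm : Integrable s P := (hi.const_mul 2).sub (integrable_const 1)
  have hs0 : ∫ x, s x ∂P = 0 := by
    rw [hs, integral_sub (hi.const_mul 2) (integrable_const 1), integral_const_mul, hint]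
    simp
  have hpt : ∀ x, (g x - m) * s x = g x - m * s x := by
    intro x
    by_cases hx : x ∈ B
    · simp [hs, hx]; ring
    · simp [hs, hx, hgB x hx]
  have : m = ∫ x, (g x - m) * s x ∂P := by
    simp_rw [hpt]
    rw [integral_sub hg (hsm.const_mul m), integral_const_mul, hs0, mul_zero, sub_zero]
  rw [this]
  refine (enorm_integral_le_lintegral_enorm _).trans (lintegral_mono fun x => ?_)
  rw [enorm_mul]
  have h1 : ‖s x‖ₑ = 1 := by
    by_cases hx : x ∈ B
    · simp [hs, hx]; norm_num
    · simp [hs, hx]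
  rw [h1, mul_one]

/-- If `B` has probability `t`, the oscillation is `2t(1 - t)`, which is largest at `t = 1/2`. -/
lemma meanOsc_indicator_one_le [IsProbabilityMeasure P] {B : Set α} (hB : MeasurableSet B) :
    meanOsc P (B.indicator 1) ≤ ENNReal.ofReal (1 / 2) := by
  have hi : Integrable (B.indicator (1 : α → ℝ)) P := (integrable_const 1).indicator hB
  rw [meanOsc, integral_indicator_one hB]
  set t := P.real B
  have ht0 : 0 ≤ t := measureReal_nonneg
  have ht1 : t ≤ 1 := measureReal_le_one
  have hpt : ∀ x, ‖B.indicator (1 : α → ℝ) x - t‖ = B.indicator 1 x * (1 - 2 * t) + t := by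
    intro x
    by_cases hx : x ∈ B
    · simp only [hx, Set.indicator_of_mem, Pi.one_apply]
      rw [Real.norm_of_nonneg (by linarith)]; ring
    · simp only [hx, not_false_eq_true, Set.indicator_of_notMem]
      rw [zero_sub, norm_neg, Real.norm_of_nonneg ht0]; ring
  have hit : Integrable (fun x => B.indicator (1 : α → ℝ) x - t) P := hi.sub (integrable_const t)
  rw [← ofReal_integral_norm_eq_lintegral_enorm hit]
  apply ENNReal.ofReal_le_ofReal
  simp_rw [hpt]
  rw [integral_add (hi.mul_const _) (integrable_const t), integral_mul_const,
    integral_indicator_one hB, integral_const, probReal_univ, one_smul]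
  change t * (1 - 2 * t) + t ≤ 1 / 2
  nlinarith [sq_nonneg (2 * t - 1)]

end Oscillation

/-! ### The sharp maximal function -/

/-- The normalized Lebesgue measure on a set. -/
noncomputable def avgMeasure (Q : Set (Fin n → ℝ)) : Measure (Fin n → ℝ) :=
  (volume.restrict Q Set.univ)⁻¹ • volume.restrict Q

lemma lintegral_avgMeasure (Q : Set (Fin n → ℝ)) (f : (Fin n → ℝ) → ℝ≥0∞) :
    ∫⁻ y, f y ∂(avgMeasure Q) = (volume Q)⁻¹ * ∫⁻ y in Q, f y := by
  rw [avgMeasure, lintegral_smul_measure, Measure.restrict_apply_univ, smul_eq_mul]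

lemma isProbabilityMeasure_avgMeasure (c : Fin n → ℝ) {r : ℝ} (hr : 0 < r) :
    IsProbabilityMeasure (avgMeasure (closedBall c r)) := by
  constructor
  rw [avgMeasure, Measure.smul_apply, Measure.restrict_apply_univ, smul_eq_mul]
  exact ENNReal.inv_mul_cancel (volume_closedBall_pos c hr).ne' (volume_closedBall_lt_top c r).ne

lemma integrable_avgMeasure {f : (Fin n → ℝ) → ℝ} {c : Fin n → ℝ} {r : ℝ} (hr : 0 < r)
    (hf : IntegrableOn f (closedBall c r)) : Integrable f (avgMeasure (closedBall c r)) := by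
  refine hf.smul_measure ?_
  rw [Measure.restrict_apply_univ]
  exact ENNReal.inv_ne_top.2 (volume_closedBall_pos c hr).ne'

lemma meanOsc_le_sharpMax (f : (Fin n → ℝ) → ℝ) {x c : Fin n → ℝ} {r : ℝ} (hr : 0 < r)
    (hx : x ∈ closedBall c r) : meanOsc (avgMeasure (closedBall c r)) f ≤ sharpMax f x :=
  le_iSup_of_le (closedBall c r) (le_iSup₂_of_le (isCube_closedBall c hr) hx le_rfl)

lemma sharpMax_le {f : (Fin n → ℝ) → ℝ} {x : Fin n → ℝ} {M : ℝ≥0∞}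
    (h : ∀ (c : Fin n → ℝ) (r : ℝ), 0 < r → x ∈ closedBall c r →
      meanOsc (avgMeasure (closedBall c r)) f ≤ M) : sharpMax f x ≤ M := by
  refine iSup_le fun Q => iSup₂_le fun hQ hx => ?_
  obtain ⟨c, r, hr, rfl⟩ := isCube_iff.1 hQ
  exact h c r hr hx

lemma exists_lt_meanOsc {f : (Fin n → ℝ) → ℝ} {x : Fin n → ℝ} {t : ℝ≥0∞} (h : t < sharpMax f x) :
    ∃ (c : Fin n → ℝ) (r : ℝ), 0 < r ∧ x ∈ closedBall c r ∧
      t < meanOsc (avgMeasure (closedBall c r)) f := by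
  by_contra! h1
  exact absurd h (not_lt.2 (sharpMax_le h1))

/-- Provides measurability. A closed cube containing `x` need not be a neighbourhood of `x`, so it
is enlarged slightly about its centre. If all enlargements had oscillation at most `t`, letting
their radii decrease to `r` would give the same for the original cube, since volumes and averages
converge. -/
lemma lowerSemicontinuous_sharpMax {f : (Fin n → ℝ) → ℝ} (hf : LocallyIntegrable f volume) :
    LowerSemicontinuous (sharpMax f) := by
  intro x t ht
  obtain ⟨c, r, hr, hx, htr⟩ := exists_lt_meanOsc ht
  have hfi : ∀ ρ, IntegrableOn f (closedBall c ρ) := fun ρ =>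
    hf.integrableOn_isCompact (isCompact_closedBall c ρ)
  obtain ⟨u, huanti, hur, hulim⟩ := exists_seq_strictAnti_tendsto r
  have hu0 : ∀ k, 0 < u k := fun k => hr.trans (hur k)
  suffices h : ∃ k, t < meanOsc (avgMeasure (closedBall c (u k))) f by
    obtain ⟨k, hk⟩ := h
    have hnhds : ball c (u k) ∈ 𝓝 x :=
      isOpen_ball.mem_nhds (mem_ball.2 ((mem_closedBall.1 hx).trans_lt (hur k)))
    filter_upwards [hnhds] with y hy
    exact hk.trans_le (meanOsc_le_sharpMax f (hu0 k) (ball_subset_closedBall hy))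
  by_contra! hall
  set V : ℝ → ℝ≥0∞ := fun ρ => volume (closedBall c ρ) with hV
  set a : ℝ → ℝ := fun ρ => ∫ z, f z ∂(avgMeasure (closedBall c ρ)) with ha
  have hVt : Tendsto (fun k => V (u k)) atTop (𝓝 (V r)) := by
    have h1 : ∀ ρ, 0 ≤ ρ → V ρ = ENNReal.ofReal ((2 * ρ) ^ n) := by
      intro ρ hρ
      rw [hV]
      simp only
      rw [Real.volume_pi_closedBall _ hρ, Fintype.card_fin]
    rw [h1 r hr.le]
    simp_rw [fun k => h1 (u k) (hu0 k).le]
    exact (ENNReal.continuous_ofReal.tendsto _).comp ((hulim.const_mul 2).pow n)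
  have hVr : V r ≠ ∞ := (volume_closedBall_lt_top c r).ne
  have hV0 : V r ≠ 0 := (volume_closedBall_pos c hr).ne'
  have hinter : ⋂ k, closedBall c (u k) = closedBall c r := by
    ext y
    simp only [Set.mem_iInter, mem_closedBall]
    exact ⟨fun h => ge_of_tendsto' hulim h, fun h k => h.trans (hur k).le⟩
  have haeq : ∀ ρ, a ρ = (V ρ).toReal⁻¹ * ∫ z in closedBall c ρ, f z := by
    intro ρ
    rw [ha]
    simp only [avgMeasure]
    rw [integral_smul_measure, Measure.restrict_apply_univ, ENNReal.toReal_inv, smul_eq_mul]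
  have hat : Tendsto (fun k => a (u k)) atTop (𝓝 (a r)) := by
    simp_rw [haeq]
    refine Tendsto.mul ?_ ?_
    · exact ((ENNReal.tendsto_toReal hVr).comp hVt).inv₀ (ENNReal.toReal_ne_zero.2 ⟨hV0, hVr⟩)
    · rw [← hinter]
      exact tendsto_setIntegral_of_antitone (fun k => measurableSet_closedBall)
        (fun i j hij => closedBall_subset_closedBall (huanti.antitone hij)) ⟨0, hfi _⟩
  have hosc : ∀ ρ, 0 < ρ → V ρ * meanOsc (avgMeasure (closedBall c ρ)) f =
      ∫⁻ y in closedBall c ρ, ‖f y - a ρ‖ₑ := by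
    intro ρ hρ
    rw [meanOsc, lintegral_avgMeasure, ← mul_assoc, ENNReal.mul_inv_cancel
      (volume_closedBall_pos c hρ).ne' (volume_closedBall_lt_top c ρ).ne, one_mul]
  have hineq : ∀ k, V r * meanOsc (avgMeasure (closedBall c r)) f ≤
      V (u k) * t + ‖a (u k) - a r‖ₑ * V r := by
    intro k
    rw [hosc r hr]
    calc ∫⁻ y in closedBall c r, ‖f y - a r‖ₑ
        ≤ ∫⁻ y in closedBall c r, (‖f y - a (u k)‖ₑ + ‖a (u k) - a r‖ₑ) := by
          refine lintegral_mono fun y => ?_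
          rw [← sub_add_sub_cancel (f y) (a (u k)) (a r)]
          exact enorm_add_le _ _
      _ = (∫⁻ y in closedBall c r, ‖f y - a (u k)‖ₑ) + ‖a (u k) - a r‖ₑ * V r := by
          rw [lintegral_add_right _ measurable_const, setLIntegral_const]
      _ ≤ (∫⁻ y in closedBall c (u k), ‖f y - a (u k)‖ₑ) + ‖a (u k) - a r‖ₑ * V r := by
          gcongr
          exact (hur k).le
      _ ≤ _ := by
          rw [← hosc _ (hu0 k)]
          gcongr
          exact hall k
  have hlim : Tendsto (fun k => V (u k) * t + ‖a (u k) - a r‖ₑ * V r) atTop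
      (𝓝 (V r * t + 0 * V r)) := by
    refine Tendsto.add ?_ ?_
    · exact ENNReal.Tendsto.mul_const hVt (Or.inl hV0)
    · refine ENNReal.Tendsto.mul_const ?_ (Or.inr hVr)
      have : Tendsto (fun k => ‖a (u k) - a r‖ₑ) atTop (𝓝 ‖a r - a r‖ₑ) :=
        (hat.sub_const (a r)).enorm
      simpa using this
  have hfinal := ge_of_tendsto' hlim hineq
  rw [zero_mul, add_zero] at hfinal
  exact absurd ((ENNReal.mul_le_mul_iff_right hV0 hVr).1 hfinal) (not_le.2 htr)

lemma measurable_sharpMax {f : (Fin n → ℝ) → ℝ} (hf : LocallyIntegrable f volume) :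
    Measurable (sharpMax f) :=
  (lowerSemicontinuous_sharpMax hf).measurable

lemma enorm_average_le_two_mul_sharpMax (hn : 1 ≤ n) {f : (Fin n → ℝ) → ℝ} {c x : Fin n → ℝ}
    {r : ℝ} (hr : 0 < r) (hf : IntegrableOn f (closedBall c r)) (hx : x ∈ closedBall c r) :
    ‖⨍ y in closedBall c r, f y‖ₑ ≤ 2 * sharpMax ((closedBall c r).indicator f) x := by
  -- The dilation factor that exactly doubles the volume, so that the original cube is half of the
  -- enlarged one.
  set K : ℝ := 2 ^ (1 / (n : ℝ)) with hK
  have hK1 : 1 ≤ K := Real.one_le_rpow (by norm_num) (by positivity)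
  have hKn : K ^ n = 2 := by
    rw [hK, ← Real.rpow_natCast, ← Real.rpow_mul (by norm_num),
      one_div_mul_cancel (by exact_mod_cast (by omega : n ≠ 0)), Real.rpow_one]
  have hrK : r ≤ K * r := le_mul_of_one_le_left hr.le hK1
  have hKr : 0 < K * r := hr.trans_le hrK
  have hsub : closedBall c r ⊆ closedBall c (K * r) := closedBall_subset_closedBall hrK
  have hvol : volume (closedBall c (K * r)) = 2 * volume (closedBall c r) := by
    rw [volume_closedBall_scale c c (by linarith) hr.le, hKn]
    simp
  have hvfin := (volume_closedBall_lt_top c r).ne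
  have hv0 : (volume (closedBall c r)).toReal ≠ 0 :=
    ENNReal.toReal_ne_zero.2 ⟨(volume_closedBall_pos c hr).ne', hvfin⟩
  have := isProbabilityMeasure_avgMeasure c hKr
  have hm : MeasurableSet (closedBall c r) := measurableSet_closedBall
  have hg : IntegrableOn ((closedBall c r).indicator f) (closedBall c (K * r)) :=
    (integrable_indicator_iff hm).2 hf |>.integrableOn
  have hP : (avgMeasure (closedBall c (K * r))).real (closedBall c r) = 1 / 2 := by
    rw [measureReal_def, avgMeasure, Measure.smul_apply, Measure.restrict_apply_univ,
      Measure.restrict_apply hm, Set.inter_eq_left.2 hsub, hvol, smul_eq_mul, ENNReal.toReal_mul,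
      ENNReal.toReal_inv, ENNReal.toReal_mul]
    simp only [ENNReal.toReal_ofNat]
    field_simp
  have h1 := enorm_integral_le_meanOsc hm hP (integrable_avgMeasure hKr hg)
    (fun x hx => Set.indicator_of_notMem hx f)
  have h2 : ⨍ y in closedBall c r, f y =
      2 * ∫ z, (closedBall c r).indicator f z ∂(avgMeasure (closedBall c (K * r))) := by
    rw [avgMeasure, integral_smul_measure, Measure.restrict_apply_univ, integral_indicator hm,
      Measure.restrict_restrict hm, Set.inter_eq_left.2 hsub, setAverage_eq, hvol, measureReal_def,
      ENNReal.toReal_inv, ENNReal.toReal_mul, smul_eq_mul, smul_eq_mul]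
    simp only [ENNReal.toReal_ofNat]
    field_simp
  rw [h2, enorm_mul]
  have h3 : ‖(2 : ℝ)‖ₑ = 2 := by simp [Real.enorm_eq_ofReal]
  rw [h3]
  gcongr
  exact h1.trans (meanOsc_le_sharpMax _ hKr (hsub hx))

lemma sharpMax_indicator_one_le {Q : Set (Fin n → ℝ)} (hQ : MeasurableSet Q) (x : Fin n → ℝ) :
    sharpMax (Q.indicator 1) x ≤ ENNReal.ofReal (1 / 2) :=
  sharpMax_le fun c _ hr _ =>
    have := isProbabilityMeasure_avgMeasure c hr
    meanOsc_indicator_one_le hQ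

lemma toReal_sharpMax_indicator_one (hn : 1 ≤ n) {c x : Fin n → ℝ} {r : ℝ} (hr : 0 < r)
    (hx : x ∈ closedBall c r) : (sharpMax ((closedBall c r).indicator 1) x).toReal = 1 / 2 := by
  have h1 := sharpMax_indicator_one_le (measurableSet_closedBall : MeasurableSet (closedBall c r)) x
  have h2 := enorm_average_le_two_mul_sharpMax hn hr (f := 1)
    (integrableOn_const (volume_closedBall_lt_top c r).ne) hx
  have hav : ⨍ y in closedBall c r, (1 : (Fin n → ℝ) → ℝ) y = 1 :=
    setAverage_const (volume_closedBall_pos c hr).ne' (volume_closedBall_lt_top c r).ne 1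
  rw [hav] at h2
  have hfin : sharpMax ((closedBall c r).indicator 1) x ≠ ∞ := ne_top_of_le_ne_top (by simp) h1
  have h3 := ENNReal.toReal_mono (by finiteness) h1
  have h4 := ENNReal.toReal_mono (by finiteness) h2
  rw [ENNReal.toReal_ofReal (by norm_num)] at h3
  simp [ENNReal.toReal_mul] at h4
  linarith

end

section

variable {n : ℕ} {μ : (Fin n → ℝ) → ℝ} {C : ℝ≥0}

/-! ### Pointwise estimate for weighted Lipschitz functions -/

lemma one_div_mul_rpow_le_iff {m X M : ℝ≥0∞} {α s : ℝ} (hs : 0 < s) (hm0 : m ≠ 0) (hm : m ≠ ∞) :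
    (1 / m ^ α) * ((1 / m) * X) ^ (1 / s) ≤ M ↔ X ^ (1 / s) ≤ M * m ^ (α + 1 / s) := by
  have h1 : m ^ (α + 1 / s) ≠ 0 := by simp [hm0, hm]
  have h2 : m ^ (α + 1 / s) ≠ ∞ := by simp [hm0, hm]
  rw [← ENNReal.div_le_iff h1 h2]
  have h3 : (1 / m ^ α) * ((1 / m) * X) ^ (1 / s) = X ^ (1 / s) / m ^ (α + 1 / s) := by
    rw [ENNReal.mul_rpow_of_nonneg _ _ (by positivity), one_div m, one_div (m ^ α),
      ENNReal.inv_rpow, ENNReal.rpow_add _ _ hm0 hm, ENNReal.div_eq_inv_mul,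
      ENNReal.mul_inv (Or.inl (by simp [hm0, hm])) (Or.inl (by simp [hm0, hm]))]
    ring
  rw [h3]

lemma IsWeight.normalizedSize_le_iff (hw : IsWeight μ) {β s : ℝ} (hs : 0 < s) {c : Fin n → ℝ}
    {r : ℝ} (hr : 0 < r) {g : (Fin n → ℝ) → ℝ} {M : ℝ≥0∞} :
    normalizedSize β s μ (closedBall c r) g ≤ M ↔
      (∫⁻ x in closedBall c r, ‖g x‖ₑ ^ s * ENNReal.ofReal (μ x ^ (1 - s))) ^ (1 / s) ≤
        M * wMeasure μ (closedBall c r) ^ (β / n + 1 / s) := by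
  rw [normalizedSize, wmass_eq]
  exact one_div_mul_rpow_le_iff hs (hw.wMeasure_closedBall_pos c hr).ne'
    (hw.wMeasure_closedBall_lt_top c r).ne

lemma IsWeight.normalizedSize_one_le_iff (hw : IsWeight μ) {β : ℝ} {c : Fin n → ℝ}
    {r : ℝ} (hr : 0 < r) {g : (Fin n → ℝ) → ℝ} {M : ℝ≥0∞} :
    normalizedSize β 1 μ (closedBall c r) g ≤ M ↔
      ∫⁻ x in closedBall c r, ‖g x‖ₑ ≤ M * wMeasure μ (closedBall c r) ^ (β / n + 1) := by
  rw [hw.normalizedSize_le_iff one_pos hr]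
  simp

lemma enorm_average_sub_le {b : (Fin n → ℝ) → ℝ} {c : Fin n → ℝ} {r : ℝ} (a : ℝ) :
    ‖⨍ y in closedBall c r, (b y - a)‖ₑ ≤
      (volume (closedBall c r))⁻¹ * ∫⁻ y in closedBall c r, ‖b y - a‖ₑ := by
  rw [← lintegral_avgMeasure]
  exact enorm_integral_le_lintegral_enorm _

lemma average_sub_const {b : (Fin n → ℝ) → ℝ} {c : Fin n → ℝ} {r : ℝ} (hr : 0 < r)
    (hb : IntegrableOn b (closedBall c r)) (a : ℝ) :
    ⨍ y in closedBall c r, (b y - a) = (⨍ y in closedBall c r, b y) - a := by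
  have := isProbabilityMeasure_avgMeasure c hr
  have h := integral_sub (integrable_avgMeasure hr hb) (integrable_const a)
  rw [integral_const, probReal_univ, one_smul] at h
  exact h

/-- At Lebesgue points `b(x)` is the limit of averages over cubes shrinking to `x`. Consecutive
averages differ by at most `2^n` mean oscillations; `A₁` turns `μ(Q_k)/|Q_k|` into `C μ(x)`, and the
remaining factor `μ(Q_k)^α` decays like `δ^(kα)`. -/
lemma exists_lip_pointwise (hw : IsWeight μ) (hA : A1Bound μ C) (hC : 0 < C) (hn : 1 ≤ n)
    {α : ℝ} (hα : 0 < α) {b : (Fin n → ℝ) → ℝ} (hb : LocallyIntegrable b volume) {L : ℝ≥0∞}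
    (hL : L ≠ ∞) (hLip : ∀ (c : Fin n → ℝ) (r : ℝ), 0 < r →
      ∫⁻ x in closedBall c r, ‖b x - ⨍ y in closedBall c r, b y‖ₑ ≤
        L * wMeasure μ (closedBall c r) ^ (α + 1)) :
    ∃ K : ℝ≥0∞, K ≠ ∞ ∧ ∀ᵐ x, ∀ (c : Fin n → ℝ) (r : ℝ), 0 < r → x ∈ closedBall c r →
      ‖b x - ⨍ y in closedBall c r, b y‖ₑ ≤ K * wt μ x * wMeasure μ (closedBall c r) ^ α := by
  obtain ⟨δ, hδ1, hδ⟩ := hA.reverse_doubling hw hC hn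
  refine ⟨2 ^ n * L * C * (1 - δ ^ α)⁻¹, ?_, ?_⟩
  · have h1 : (1 - δ ^ α)⁻¹ ≠ ∞ :=
      ENNReal.inv_ne_top.2 (tsub_pos_of_lt (ENNReal.rpow_lt_one hδ1 hα)).ne'
    finiteness
  filter_upwards [hA, IsUnifLocDoublingMeasure.ae_tendsto_average (μ := volume) hb 1]
    with x hxA hxL c r hr hxB
  -- Images of the given cube under the homotheties of centre `x` and ratio `2^(-k)`: they are
  -- nested and all contain `x`, though they need not be centred at it.
  set cs : ℕ → (Fin n → ℝ) := fun k => x + ((1 : ℝ) / 2) ^ k • (c - x) with hcs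
  set rs : ℕ → ℝ := fun k => (1 / 2) ^ k * r with hrs
  have hrs0 : ∀ k, 0 < rs k := fun k => by positivity
  have hrs1 : ∀ k, rs (k + 1) = rs k / 2 := fun k => by simp only [hrs, pow_succ]; ring
  have hmem : ∀ k, x ∈ closedBall (cs k) (rs k) := by
    intro k
    rw [mem_closedBall, dist_eq_norm, hcs]
    simp only [sub_add_cancel_left, norm_neg, norm_smul, norm_pow]
    rw [hrs, ← dist_eq_norm, dist_comm, Real.norm_of_nonneg (by norm_num)]
    exact mul_le_mul_of_nonneg_left (mem_closedBall.1 hxB) (by positivity)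
  have hnest : ∀ k, closedBall (cs (k + 1)) (rs (k + 1)) ⊆ closedBall (cs k) (rs k) := by
    intro k
    refine closedBall_subset_closedBall' ?_
    have h1 : dist (cs (k + 1)) (cs k) = rs (k + 1) / r * dist x c := by
      rw [dist_eq_norm, dist_eq_norm, hcs, ← norm_neg]
      have : -(x + ((1 : ℝ) / 2) ^ (k + 1) • (c - x) - (x + ((1 : ℝ) / 2) ^ k • (c - x))) =
          -(((1 : ℝ) / 2) ^ (k + 1)) • (x - c) := by
        rw [pow_succ]; module
      rw [this, norm_smul, norm_neg, Real.norm_of_nonneg (by positivity), hrs]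
      field_simp
    have h2 : rs (k + 1) / r * dist x c ≤ rs (k + 1) / r * r := by
      gcongr
      exact mem_closedBall.1 hxB
    rw [h1]
    rw [div_mul_cancel₀ _ hr.ne'] at h2
    have := hrs1 k
    linarith
  have hν : ∀ k, wMeasure μ (closedBall (cs k) (rs k)) ≤ δ ^ k * wMeasure μ (closedBall c r) := by
    intro k
    induction k with
    | zero => simp [hcs, hrs]
    | succ k ih =>
      have h1 := hnest k
      rw [hrs1] at h1 ⊢
      refine (hδ _ _ _ (hrs0 k) h1).trans ?_
      rw [pow_succ', mul_assoc]
      gcongr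
  have hint : ∀ k, IntegrableOn b (closedBall (cs k) (rs k)) := fun k =>
    hb.integrableOn_isCompact (isCompact_closedBall _ _)
  have hstep : ∀ k, edist (⨍ y in closedBall (cs k) (rs k), b y)
      (⨍ y in closedBall (cs (k + 1)) (rs (k + 1)), b y) ≤
      2 ^ n * L * C * wt μ x * wMeasure μ (closedBall c r) ^ α * (δ ^ α) ^ k := by
    intro k
    set a := ⨍ y in closedBall (cs k) (rs k), b y
    set v := volume (closedBall (cs k) (rs k)) with hv
    set m := wMeasure μ (closedBall (cs k) (rs k)) with hm
    have hv0 : v ≠ 0 := (volume_closedBall_pos _ (hrs0 k)).ne'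
    have hvt : v ≠ ∞ := (volume_closedBall_lt_top _ _).ne
    have hm0 : m ≠ 0 := (hw.wMeasure_closedBall_pos _ (hrs0 k)).ne'
    have hmt : m ≠ ∞ := (hw.wMeasure_closedBall_lt_top _ _).ne
    have hvk : (volume (closedBall (cs (k + 1)) (rs (k + 1))))⁻¹ = 2 ^ n * v⁻¹ := by
      rw [hrs1, show rs k / 2 = (1 / 2) * rs k by ring,
        volume_closedBall_scale (cs k) _ (by norm_num) (hrs0 k).le,
        ENNReal.mul_inv (Or.inr hvt) (Or.inr hv0), ← ENNReal.ofReal_inv_of_pos (by positivity)]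
      congr 1
      rw [one_div, inv_pow, inv_inv, ENNReal.ofReal_pow (by norm_num)]
      simp
    rw [edist_comm, edist_eq_enorm_sub, ← average_sub_const (hrs0 _) (hint _)]
    have hmA : v⁻¹ * m ≤ C * wt μ x := by
      rw [← ENNReal.div_eq_inv_mul, ENNReal.div_le_iff hv0 hvt]
      exact hxA _ _ (hrs0 k) (hmem k)
    calc _ ≤ (volume (closedBall (cs (k + 1)) (rs (k + 1))))⁻¹ *
            ∫⁻ y in closedBall (cs (k + 1)) (rs (k + 1)), ‖b y - a‖ₑ :=
          enorm_average_sub_le a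
      _ ≤ (2 ^ n * v⁻¹) * (L * m ^ (α + 1)) := by
          rw [hvk]
          gcongr
          exact (lintegral_mono_set (hnest k)).trans (hLip _ _ (hrs0 k))
      _ = 2 ^ n * L * m ^ α * (v⁻¹ * m) := by
          rw [ENNReal.rpow_add _ _ hm0 hmt, ENNReal.rpow_one]; ring
      _ ≤ 2 ^ n * L * (δ ^ k * wMeasure μ (closedBall c r)) ^ α * (C * wt μ x) := by
          gcongr
          exact hν k
      _ = _ := by
          rw [ENNReal.mul_rpow_of_nonneg _ _ hα.le, ← ENNReal.rpow_natCast_mul, mul_comm (k : ℝ),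
            ENNReal.rpow_mul_natCast]
          ring
  have hlim0 : Tendsto rs atTop (𝓝[>] 0) := by
    rw [tendsto_nhdsWithin_iff]
    refine ⟨?_, Eventually.of_forall hrs0⟩
    have := (tendsto_pow_atTop_nhds_zero_of_lt_one (r := (1 : ℝ) / 2) (by norm_num)
      (by norm_num)).mul_const r
    rwa [zero_mul] at this
  have hlim := hxL cs rs hlim0 (Eventually.of_forall fun k => by rw [one_mul]; exact hmem k)
  have hsum := edist_le_tsum_of_edist_le_of_tendsto₀ _ hstep hlim
  rw [ENNReal.tsum_mul_left, ENNReal.tsum_geometric, edist_comm, edist_eq_enorm_sub] at hsum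
  have h0 : cs 0 = c ∧ rs 0 = r := by simp [hcs, hrs]
  rw [h0.1, h0.2] at hsum
  refine hsum.trans (le_of_eq ?_)
  ring

end

section

variable {n : ℕ} {μ : (Fin n → ℝ) → ℝ} {C : ℝ≥0}

/-! ### The weighted fractional maximal function on Morrey spaces -/

/-- The fractional maximal function of order `α` with respect to `ν`. -/
noncomputable def fracMax (ν : Measure (Fin n → ℝ)) (α : ℝ) (f : (Fin n → ℝ) → ℝ≥0∞)
    (x : Fin n → ℝ) : ℝ≥0∞ :=
  ⨆ (c : Fin n → ℝ) (r : ℝ) (_ : 0 < r ∧ x ∈ closedBall c r),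
    ν (closedBall c r) ^ α * ((ν (closedBall c r))⁻¹ * ∫⁻ y in closedBall c r, f y ∂ν)

lemma le_fracMax {ν : Measure (Fin n → ℝ)} {α : ℝ} {f : (Fin n → ℝ) → ℝ≥0∞} {x c : Fin n → ℝ}
    {r : ℝ} (hr : 0 < r) (hx : x ∈ closedBall c r) :
    ν (closedBall c r) ^ α * ((ν (closedBall c r))⁻¹ * ∫⁻ y in closedBall c r, f y ∂ν) ≤
      fracMax ν α f x :=
  le_iSup_of_le c (le_iSup₂_of_le r ⟨hr, hx⟩ le_rfl)

lemma setLIntegral_mean_le_rpow {α : Type*} [MeasurableSpace α] {ν : Measure α} {S : Set α}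
    (h0 : ν S ≠ 0) (ht : ν S ≠ ∞) {f : α → ℝ≥0∞} (hf : AEMeasurable f ν) {p : ℝ} (hp : 1 < p) :
    (ν S)⁻¹ * ∫⁻ y in S, f y ∂ν ≤ ((ν S)⁻¹ * ∫⁻ y in S, f y ^ p ∂ν) ^ (1 / p) := by
  have hp0 : 0 < p := by linarith
  have hpq := Real.HolderConjugate.conjExponent hp
  have h := ENNReal.lintegral_mul_le_Lp_mul_Lq (ν.restrict S) hpq hf.restrict
    (aemeasurable_const (b := (1 : ℝ≥0∞)))
  simp only [Pi.mul_apply, mul_one, ENNReal.one_rpow, setLIntegral_const, one_mul] at h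
  have he : 1 / p.conjExponent = 1 + -(1 / p) := by
    have := hpq.inv_add_inv_eq_one
    rw [one_div, one_div]; linarith
  rw [he, ENNReal.rpow_add _ _ h0 ht, ENNReal.rpow_one] at h
  calc (ν S)⁻¹ * ∫⁻ y in S, f y ∂ν
      ≤ (ν S)⁻¹ * ((∫⁻ y in S, f y ^ p ∂ν) ^ (1 / p) * (ν S * ν S ^ (-(1 / p)))) := by gcongr
    _ = ((ν S)⁻¹ * ν S) * (ν S ^ (-(1 / p)) * (∫⁻ y in S, f y ^ p ∂ν) ^ (1 / p)) := by ring
    _ = _ := by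
        rw [ENNReal.inv_mul_cancel h0 ht, one_mul, ENNReal.mul_rpow_of_nonneg _ _ (by positivity),
          ENNReal.inv_rpow, ENNReal.rpow_neg]

/-- The Morrey condition `∫_B f ^ p dν ≤ N ^ p ν(B) ^ κ` on all balls `B`. -/
def MorreyBound (ν : Measure (Fin n → ℝ)) (p κ : ℝ) (f : (Fin n → ℝ) → ℝ≥0∞) (N : ℝ≥0∞) : Prop :=
  ∀ (c : Fin n → ℝ) (r : ℝ), 0 < r →
    ∫⁻ y in closedBall c r, f y ^ p ∂ν ≤ N ^ p * ν (closedBall c r) ^ κ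

/-- Hedberg's splitting at radius `R`. For small balls with mean `a` of `f ^ p`, the Morrey
condition gives `μ(B)^(1-κ) a ≤ N^p`; its power `α / (1 - κ)` absorbs `μ(B)^α`, and the remaining
power of `a` is left to the local maximal function. Large balls use the Morrey condition alone:
`μ(B)` then has the negative exponent `α - (1-κ)/p`, and `μ(B)` dominates a multiple of the mass of
`closedBall z R`, which lies in `3B`. -/
lemma fracMax_le_max (hw : IsWeight μ) (hA : A1Bound μ C) {p κ α : ℝ} (hp : 1 < p)
    (hκ1 : κ < 1) (hα0 : 0 ≤ α) (hα : α < (1 - κ) / p) {f : (Fin n → ℝ) → ℝ≥0∞}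
    (hf : AEMeasurable f volume) {N : ℝ≥0∞} (hM : MorreyBound (wMeasure μ) p κ f N)
    {z x : Fin n → ℝ} {R : ℝ} (hR : 0 < R) (hx : x ∈ closedBall z R) :
    fracMax (wMeasure μ) α f x ≤
      max ((N ^ p) ^ (α / (1 - κ)) *
          locMax (wMeasure μ) R (fun y => f y ^ p) x ^ (1 / p - α / (1 - κ)))
        ((C * ENNReal.ofReal (3 ^ n)) ^ ((1 - κ) / p - α) * N *
          wMeasure μ (closedBall z R) ^ (α - (1 - κ) / p)) := by
  have hp0 : 0 < p := by linarith
  have hκ' : 0 < 1 - κ := by linarith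
  have hθ0 : 0 ≤ α / (1 - κ) := by positivity
  have hθ1 : 0 ≤ 1 / p - α / (1 - κ) := by
    rw [sub_nonneg, div_le_div_iff₀ hκ' hp0]
    rw [lt_div_iff₀ hp0] at hα
    linarith
  have he : 0 < (1 - κ) / p - α := by linarith
  refine iSup_le fun c => iSup₂_le fun r ⟨hr, hxr⟩ => ?_
  set m := wMeasure μ (closedBall c r) with hm
  have hm0 : m ≠ 0 := (hw.wMeasure_closedBall_pos c hr).ne'
  have hmt : m ≠ ∞ := (hw.wMeasure_closedBall_lt_top c r).ne
  set a := m⁻¹ * ∫⁻ y in closedBall c r, f y ^ p ∂(wMeasure μ) with ha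
  have hmean : m⁻¹ * ∫⁻ y in closedBall c r, f y ∂(wMeasure μ) ≤ a ^ (1 / p) :=
    setLIntegral_mean_le_rpow hm0 hmt (hf.mono_ac wMeasure_absolutelyContinuous) hp
  have hma : m ^ (1 - κ) * a ≤ N ^ p := by
    calc m ^ (1 - κ) * a ≤ m ^ (1 - κ) * (m⁻¹ * (N ^ p * m ^ κ)) := by
          rw [ha]; gcongr; exact hM c r hr
      _ = m ^ (1 - κ) * m ^ (-1 : ℝ) * m ^ κ * N ^ p := by rw [ENNReal.rpow_neg_one]; ring
      _ = N ^ p := by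
          rw [← ENNReal.rpow_add _ _ hm0 hmt, ← ENNReal.rpow_add _ _ hm0 hmt]
          ring_nf
          simp
  have hle : m ^ α * (m⁻¹ * ∫⁻ y in closedBall c r, f y ∂(wMeasure μ)) ≤ m ^ α * a ^ (1 / p) := by
    gcongr
  refine hle.trans ?_
  rcases le_or_gt r R with hrR | hrR
  · refine le_trans ?_ (le_max_left _ _)
    have hloc : a ≤ locMax (wMeasure μ) R (fun y => f y ^ p) x := le_locMax hr hrR hxr
    calc m ^ α * a ^ (1 / p)
        = (m ^ (1 - κ) * a) ^ (α / (1 - κ)) * a ^ (1 / p - α / (1 - κ)) := by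
          rw [ENNReal.mul_rpow_of_nonneg _ _ hθ0, ← ENNReal.rpow_mul, mul_assoc,
            ← ENNReal.rpow_add_of_nonneg _ _ hθ0 hθ1, mul_div_cancel₀ _ hκ'.ne',
            add_sub_cancel]
      _ ≤ _ := by gcongr
  · refine le_trans ?_ (le_max_right _ _)
    have hsub : closedBall z R ⊆ closedBall c (3 * r) := by
      refine closedBall_subset_closedBall' ?_
      have h1 := mem_closedBall.1 hx
      have h2 := mem_closedBall.1 hxr
      have h3 := dist_triangle_left z c x
      linarith
    have hQ : wMeasure μ (closedBall z R) ≤ C * ENNReal.ofReal (3 ^ n) * m :=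
      (measure_mono hsub).trans (hA.doubling hr (by norm_num)
        (closedBall_subset_closedBall (by linarith)))
    have hQ0 : wMeasure μ (closedBall z R) ≠ 0 := (hw.wMeasure_closedBall_pos z hR).ne'
    have hQt : wMeasure μ (closedBall z R) ≠ ∞ := (hw.wMeasure_closedBall_lt_top z R).ne
    set v := wMeasure μ (closedBall z R)
    set D : ℝ≥0∞ := C * ENNReal.ofReal (3 ^ n) with hD
    have haN : a ^ (1 / p) ≤ N * m ^ (-((1 - κ) / p)) := by
      have h1 : a ≤ N ^ p * m ^ (-(1 - κ)) := by
        rw [ENNReal.rpow_neg, ← div_eq_mul_inv,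
          ENNReal.le_div_iff_mul_le (Or.inl (by simp [hm0, hmt])) (Or.inl (by simp [hm0, hmt]))]
        rw [mul_comm]; exact hma
      calc a ^ (1 / p) ≤ (N ^ p * m ^ (-(1 - κ))) ^ (1 / p) := by gcongr
        _ = _ := by
          rw [ENNReal.mul_rpow_of_nonneg _ _ (by positivity), ← ENNReal.rpow_mul,
            ← ENNReal.rpow_mul, mul_one_div_cancel hp0.ne', ENNReal.rpow_one, neg_mul,
            mul_one_div]
    have hvm : m ^ (-((1 - κ) / p - α)) ≤
        D ^ ((1 - κ) / p - α) * v ^ (-((1 - κ) / p - α)) := by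
      have h1 : v ^ ((1 - κ) / p - α) ≤ D ^ ((1 - κ) / p - α) * m ^ ((1 - κ) / p - α) := by
        rw [← ENNReal.mul_rpow_of_nonneg _ _ he.le]
        gcongr
      rw [ENNReal.rpow_neg, ENNReal.rpow_neg, ← div_eq_mul_inv,
        ENNReal.le_div_iff_mul_le (Or.inl (by simp [hQ0, hQt])) (Or.inl (by simp [hQ0, hQt])),
        mul_comm, ← div_eq_mul_inv,
        ENNReal.div_le_iff (by simp [hm0, hmt]) (by simp [hm0, hmt])]
      exact h1
    calc m ^ α * a ^ (1 / p) ≤ m ^ α * (N * m ^ (-((1 - κ) / p))) := by gcongr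
      _ = N * m ^ (-((1 - κ) / p - α)) := by
          rw [neg_sub, sub_eq_add_neg α, ENNReal.rpow_add _ _ hm0 hmt]; ring
      _ ≤ N * (D ^ ((1 - κ) / p - α) * v ^ (-((1 - κ) / p - α))) := by gcongr
      _ = _ := by rw [neg_sub]; ring

/-- Balls of radius at most `R` meeting `closedBall z R` only see `f` on the concentric cube of
radius `3R`, where the Morrey condition bounds the integral. -/
lemma A1Bound.weak_type_morrey (hw : IsWeight μ) (hA : A1Bound μ C) {p κ : ℝ} (hκ0 : 0 < κ)
    {f : (Fin n → ℝ) → ℝ≥0∞} {N : ℝ≥0∞} (hM : MorreyBound (wMeasure μ) p κ f N)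
    (z : Fin n → ℝ) {R : ℝ} (hR : 0 < R) (t : ℝ≥0∞) :
    t * wMeasure μ (closedBall z R ∩ {x | t < locMax (wMeasure μ) R (fun y => f y ^ p) x}) ≤
      C * ENNReal.ofReal (4 ^ n) * (C * ENNReal.ofReal (3 ^ n)) ^ κ *
        (N ^ p * wMeasure μ (closedBall z R) ^ κ) := by
  have h1 := weak_type_locMax (ν := wMeasure μ) (D := C * ENNReal.ofReal (4 ^ n))
    (fun c r hr => hA.doubling hr (by norm_num) (closedBall_subset_closedBall (by linarith)))
    (fun c r hr => hw.wMeasure_closedBall_pos c hr) hw.wMeasure_closedBall_lt_top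
    (fun y => f y ^ p) z R R t
  refine h1.trans ?_
  rw [show R + 2 * R = 3 * R by ring]
  calc _ ≤ C * ENNReal.ofReal (4 ^ n) * (N ^ p *
        (C * ENNReal.ofReal (3 ^ n) * wMeasure μ (closedBall z R)) ^ κ) := by
        gcongr
        refine (hM z (3 * R) (by positivity)).trans ?_
        gcongr
        exact hA.doubling hR (by norm_num) (closedBall_subset_closedBall (by linarith))
    _ = _ := by rw [ENNReal.mul_rpow_of_nonneg _ _ hκ0.le]; ring

/-- Allowing `α = 0` also yields finiteness of `M^♯ f`; positive `α` serves for `M^♯(bf)`. -/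
lemma ae_fracMax_lt_top (hw : IsWeight μ) (hA : A1Bound μ C) {p κ α : ℝ} (hp : 1 < p)
    (hκ0 : 0 < κ) (hκ1 : κ < 1) (hα0 : 0 ≤ α) (hα : α < (1 - κ) / p)
    {f : (Fin n → ℝ) → ℝ≥0∞} (hf : AEMeasurable f volume) {N : ℝ≥0∞} (hN : N ≠ ∞)
    (hM : MorreyBound (wMeasure μ) p κ f N) : ∀ᵐ x, fracMax (wMeasure μ) α f x < ∞ := by
  have hp0 : 0 < p := by linarith
  have hκ' : 0 < 1 - κ := by linarith
  have hNp : N ^ p ≠ ∞ := ENNReal.rpow_ne_top_of_nonneg hp0.le hN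
  have hnull : ∀ᵐ x, ∀ k : ℕ, x ∉ closedBall (0 : Fin n → ℝ) (k + 1) ∩
      {x | locMax (wMeasure μ) (k + 1) (fun y => f y ^ p) x = ∞} := by
    rw [ae_all_iff]
    intro k
    refine hw.absolutelyContinuous_wMeasure.ae_le (measure_eq_zero_iff_ae_notMem.1 ?_)
    have hk : (0 : ℝ) < k + 1 := by positivity
    have hmt := ENNReal.rpow_ne_top_of_nonneg hκ0.le
      (hw.wMeasure_closedBall_lt_top (0 : Fin n → ℝ) (k + 1)).ne
    have hDt : ((C : ℝ≥0∞) * ENNReal.ofReal (3 ^ n)) ^ κ ≠ ∞ :=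
      ENNReal.rpow_ne_top_of_nonneg hκ0.le (by finiteness)
    exact measure_inter_eq_top_eq_zero (by finiteness)
      (fun t _ => hA.weak_type_morrey hw hκ0 hM 0 hk t)
  filter_upwards [hnull] with x hx
  obtain ⟨k, hk⟩ := exists_nat_ge (dist x 0)
  have hxk : x ∈ closedBall (0 : Fin n → ℝ) (k + 1) := mem_closedBall.2 (by linarith)
  have hkp : (0 : ℝ) < k + 1 := by positivity
  have hloc : locMax (wMeasure μ) (k + 1) (fun y => f y ^ p) x ≠ ∞ := fun h => hx k ⟨hxk, h⟩
  refine (fracMax_le_max hw hA hp hκ1 hα0 hα hf hM hkp hxk).trans_lt ?_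
  have hθ1 : 0 ≤ 1 / p - α / (1 - κ) := by
    rw [sub_nonneg, div_le_div_iff₀ hκ' hp0]
    rw [lt_div_iff₀ hp0] at hα
    linarith
  have hQ0 := (hw.wMeasure_closedBall_pos (0 : Fin n → ℝ) hkp).ne'
  have hQt := (hw.wMeasure_closedBall_lt_top (0 : Fin n → ℝ) (k + 1)).ne
  refine max_lt (ENNReal.mul_lt_top ?_ ?_) (ENNReal.mul_lt_top (ENNReal.mul_lt_top ?_ hN.lt_top) ?_)
  · exact (ENNReal.rpow_ne_top_of_nonneg (by positivity) hNp).lt_top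
  · exact (ENNReal.rpow_ne_top_of_nonneg hθ1 hloc).lt_top
  · exact (ENNReal.rpow_ne_top_of_nonneg (by linarith) (by finiteness)).lt_top
  · exact (ENNReal.rpow_ne_top_of_ne_zero hQ0 hQt).lt_top

lemma exists_fracMax_morrey (hw : IsWeight μ) (hA : A1Bound μ C) {p q κ α : ℝ} (hp : 1 < p)
    (hκ0 : 0 < κ) (hκ1 : κ < 1) (hα0 : 0 < α) (hα : α < (1 - κ) / p) (hq : 1 / q = 1 / p - α)
    (hq0 : 0 < q) :
    ∃ K : ℝ≥0∞, K ≠ ∞ ∧ ∀ (f : (Fin n → ℝ) → ℝ≥0∞) (N : ℝ≥0∞), AEMeasurable f volume → N ≠ 0 →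
      N ≠ ∞ → MorreyBound (wMeasure μ) p κ f N → ∀ (z : Fin n → ℝ) (R : ℝ), 0 < R →
      ∫⁻ x in closedBall z R, fracMax (wMeasure μ) α f x ^ q ∂(wMeasure μ) ≤
        K * N ^ q * wMeasure μ (closedBall z R) ^ (κ * q / p) := by
  have hp0 : 0 < p := by linarith
  have hκ' : 0 < 1 - κ := by linarith
  set θ := α / (1 - κ) with hθ
  have hθ0 : 0 < θ := by positivity
  have hθα : α < θ := by
    rw [hθ, lt_div_iff₀ hκ']; nlinarith
  have hθ1 : 0 < 1 / p - θ := by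
    rw [sub_pos, hθ, div_lt_div_iff₀ hκ' hp0]
    rw [lt_div_iff₀ hp0] at hα
    linarith
  -- The exponent left on the local maximal function after raising the splitting to the power `q`.
  -- Positivity of `κ` gives `θ > α`, hence `s < 1`, and Kolmogorov's inequality applies.
  set s := q * (1 / p - θ) with hs
  have hs0 : 0 < s := by positivity
  have hs1 : s < 1 := by
    have : 1 / p - θ < 1 / q := by linarith
    rwa [lt_div_iff₀ hq0, mul_comm] at this
  have he : 0 < (1 - κ) / p - α := by linarith
  set D : ℝ≥0∞ := C * ENNReal.ofReal (4 ^ n) * (C * ENNReal.ofReal (3 ^ n)) ^ κ with hD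
  have hDt : D ≠ ∞ := by
    have : ((C : ℝ≥0∞) * ENNReal.ofReal (3 ^ n)) ^ κ ≠ ∞ :=
      ENNReal.rpow_ne_top_of_nonneg hκ0.le (by finiteness)
    finiteness
  obtain ⟨K, hK, hKol⟩ := exists_setLIntegral_rpow_le hs0 hs1 hDt
  set E : ℝ≥0∞ := ((C * ENNReal.ofReal (3 ^ n)) ^ ((1 - κ) / p - α)) ^ q with hE
  have hEt : E ≠ ∞ := ENNReal.rpow_ne_top_of_nonneg hq0.le
    (ENNReal.rpow_ne_top_of_nonneg he.le (by finiteness))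
  refine ⟨K + E, by finiteness, ?_⟩
  intro f N hf hN0 hN hM z R hR
  set m := wMeasure μ (closedBall z R) with hm
  have hm0 : m ≠ 0 := (hw.wMeasure_closedBall_pos z hR).ne'
  have hmt : m ≠ ∞ := (hw.wMeasure_closedBall_lt_top z R).ne
  set A := locMax (wMeasure μ) R (fun y => f y ^ p) with hAdef
  have hNp0 : N ^ p ≠ 0 := by simp [hN0, hN]
  have hNpt : N ^ p ≠ ∞ := by simp [hN0, hN]
  have hexp1 : κ * q / p = q * (α - (1 - κ) / p) + 1 := by
    have h1 : q * (1 / q) = 1 := mul_one_div_cancel hq0.ne'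
    have h2 : α = 1 / p - 1 / q := by linarith
    rw [h2]
    field_simp
    ring
  have hexp2 : κ * q / p = (κ - 1) * s + 1 := by
    rw [hexp1, hs, hθ]
    field_simp
    ring
  -- The level `N^p μ(Q)^(κ-1)` is the Morrey bound for the mean of `f ^ p` over `Q`; it is nonzero
  -- because `N ≠ 0`.
  have hT := hKol (wMeasure μ) (closedBall z R) A (N ^ p * m ^ (κ - 1)) measurableSet_closedBall
    hmt (mul_ne_zero hNp0 (by simp [hm0, hmt])) (ENNReal.mul_ne_top hNpt (by simp [hm0, hmt]))
    (fun t _ => by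
      refine (hA.weak_type_morrey hw hκ0 hM z hR t).trans (le_of_eq ?_)
      rw [← hD, mul_assoc D, mul_assoc (N ^ p), ← hm]
      congr 2
      nth_rw 3 [← ENNReal.rpow_one m]
      rw [← ENNReal.rpow_add _ _ hm0 hmt, sub_add_cancel])
  have hpt : ∀ x ∈ closedBall z R, fracMax (wMeasure μ) α f x ^ q ≤
      (N ^ p) ^ (q * θ) * A x ^ s + E * N ^ q * m ^ (q * (α - (1 - κ) / p)) := by
    intro x hx
    have h1 := fracMax_le_max hw hA hp hκ1 hα0.le hα hf hM hR hx
    have h2 : ∀ a b : ℝ≥0∞, max a b ^ q ≤ a ^ q + b ^ q := by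
      intro a b
      rcases le_total a b with h | h
      · rw [max_eq_right h]; exact le_add_self
      · rw [max_eq_left h]; exact le_self_add
    refine (ENNReal.rpow_le_rpow h1 hq0.le).trans ((h2 _ _).trans (le_of_eq ?_))
    rw [ENNReal.mul_rpow_of_nonneg _ _ hq0.le, ENNReal.mul_rpow_of_nonneg _ _ hq0.le,
      ENNReal.mul_rpow_of_nonneg _ _ hq0.le, ← ENNReal.rpow_mul m, ← ENNReal.rpow_mul (N ^ p),
      ← ENNReal.rpow_mul (locMax _ _ _ _), mul_comm _ q, mul_comm _ q, mul_comm _ q]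
  have hconst : (N ^ p) ^ (q * θ) ≠ ∞ := by simp [hNp0, hNpt]
  calc ∫⁻ x in closedBall z R, fracMax (wMeasure μ) α f x ^ q ∂(wMeasure μ)
      ≤ ∫⁻ x in closedBall z R, ((N ^ p) ^ (q * θ) * A x ^ s +
          E * N ^ q * m ^ (q * (α - (1 - κ) / p))) ∂(wMeasure μ) :=
        setLIntegral_mono' measurableSet_closedBall hpt
    _ = (N ^ p) ^ (q * θ) * ∫⁻ x in closedBall z R, A x ^ s ∂(wMeasure μ) +
          E * N ^ q * (m ^ (q * (α - (1 - κ) / p)) * m) := by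
        rw [lintegral_add_right _ measurable_const, lintegral_const_mul' _ _ hconst,
          setLIntegral_const]
        ring
    _ ≤ (N ^ p) ^ (q * θ) * (K * (N ^ p * m ^ (κ - 1)) ^ s * m) +
          E * N ^ q * (m ^ (q * (α - (1 - κ) / p)) * m) := by gcongr
    _ = (K * ((N ^ p) ^ (q * θ) * (N ^ p) ^ s)) * (m ^ ((κ - 1) * s) * m) +
          E * N ^ q * (m ^ (q * (α - (1 - κ) / p)) * m) := by
        rw [ENNReal.mul_rpow_of_nonneg _ _ hs0.le, ENNReal.rpow_mul m (κ - 1) s]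
        ring
    _ = _ := by
        have h3 : (N ^ p) ^ (q * θ) * (N ^ p) ^ s = N ^ q := by
          rw [← ENNReal.rpow_add _ _ hNp0 hNpt, ← ENNReal.rpow_mul]
          congr 1
          rw [hs]
          field_simp
          ring
        have h4 : ∀ e : ℝ, m ^ e * m = m ^ (e + 1) := fun e => by
          rw [ENNReal.rpow_add _ _ hm0 hmt, ENNReal.rpow_one]
        rw [h3, h4, h4, ← hexp1, ← hexp2]
        ring

end

section

variable {n : ℕ} {μ b f : (Fin n → ℝ) → ℝ} {C : ℝ≥0} {K : ℝ≥0∞} {α : ℝ}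

/-! ### Commutator estimates -/

lemma IsWeight.morreyNorm_le_iff (hw : IsWeight μ) {p κ : ℝ} (hp : 0 < p)
    {u g : (Fin n → ℝ) → ℝ} {N : ℝ≥0∞} :
    morreyNorm p κ u μ g ≤ N ↔ ∀ (c : Fin n → ℝ) (r : ℝ), 0 < r →
      ∫⁻ x in closedBall c r, ‖g x‖ₑ ^ p * ENNReal.ofReal (u x) ≤
        N ^ p * wMeasure μ (closedBall c r) ^ κ := by
  have key : ∀ (c : Fin n → ℝ) (r : ℝ), 0 < r → ∀ X : ℝ≥0∞,
      (((1 / wmass μ (closedBall c r) ^ κ) * X) ^ (1 / p) ≤ N ↔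
        X ≤ N ^ p * wMeasure μ (closedBall c r) ^ κ) := by
    intro c r hr X
    have h0 := (hw.wMeasure_closedBall_pos c hr).ne'
    have ht := (hw.wMeasure_closedBall_lt_top c r).ne
    rw [wmass_eq, one_div p, ENNReal.rpow_inv_le_iff hp, one_div, mul_comm, ← div_eq_mul_inv,
      ENNReal.div_le_iff (by simp [h0, ht]) (by simp [h0, ht])]
  constructor
  · intro h c r hr
    rw [← key c r hr]
    exact (le_iSup₂_of_le (closedBall c r) (isCube_closedBall c hr) le_rfl).trans h
  · intro h
    refine iSup₂_le fun Q hQ => ?_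
    obtain ⟨c, r, hr, rfl⟩ := isCube_iff.1 hQ
    exact (key c r hr _).2 (h c r hr)

lemma IsWeight.morreyBound_of_le (hw : IsWeight μ) {p κ : ℝ} (hp : 0 < p) {N : ℝ≥0∞}
    (h : morreyNorm p κ μ μ f ≤ N) : MorreyBound (wMeasure μ) p κ (fun x => ‖f x‖ₑ) N := by
  intro c r hr
  rw [hw.setLIntegral_wMeasure]
  exact (hw.morreyNorm_le_iff hp).1 h c r hr

/-- Lebesgue integrals over cubes are controlled by weighted ones. -/
lemma A1Bound.setLIntegral_le (hw : IsWeight μ) (hA : A1Bound μ C) (g : (Fin n → ℝ) → ℝ≥0∞)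
    (c : Fin n → ℝ) {r : ℝ} (hr : 0 < r) :
    ∫⁻ y in closedBall c r, g y ≤ C * volume (closedBall c r) *
      ((wMeasure μ (closedBall c r))⁻¹ * ∫⁻ y in closedBall c r, g y ∂(wMeasure μ)) := by
  have hm0 := (hw.wMeasure_closedBall_pos c hr).ne'
  have hmt := (hw.wMeasure_closedBall_lt_top c r).ne
  have hvt := (volume_closedBall_lt_top c r).ne
  set m := wMeasure μ (closedBall c r) with hm
  have h : m * ∫⁻ y in closedBall c r, g y ≤
      C * volume (closedBall c r) * ∫⁻ y in closedBall c r, g y ∂(wMeasure μ) := by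
    rw [hw.setLIntegral_wMeasure, ← lintegral_const_mul' _ _ hmt,
      ← lintegral_const_mul' _ _ (by finiteness)]
    refine setLIntegral_mono_ae' measurableSet_closedBall ?_
    filter_upwards [hA] with y hy hyB
    calc m * g y ≤ (C * wt μ y * volume (closedBall c r)) * g y := by
          gcongr; exact hy c r hr hyB
      _ = _ := by ring
  calc ∫⁻ y in closedBall c r, g y = m⁻¹ * (m * ∫⁻ y in closedBall c r, g y) := by
        rw [← mul_assoc, ENNReal.inv_mul_cancel hm0 hmt, one_mul]
    _ ≤ m⁻¹ * (C * volume (closedBall c r) * ∫⁻ y in closedBall c r, g y ∂(wMeasure μ)) := by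
        gcongr
    _ = _ := by ring

/-- The pointwise weighted Lipschitz condition. -/
def LipPointwise (μ b : (Fin n → ℝ) → ℝ) (α : ℝ) (K : ℝ≥0∞) : Prop :=
  ∀ᵐ x, ∀ (c : Fin n → ℝ) (r : ℝ), 0 < r → x ∈ closedBall c r →
    ‖b x - ⨍ y in closedBall c r, b y‖ₑ ≤ K * wt μ x * wMeasure μ (closedBall c r) ^ α

/-- Passing through `b_Q` bounds `|b(y) - b(x)|` by `K (μ(y) + μ(x)) μ(Q)^α`. The `μ(y)` part is
already an integral against `μ dx`, and the `μ(x)` part becomes one by `A₁`; each contributes `K C`,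
hence the factor 2. -/
lemma LipPointwise.average_mul_le (hw : IsWeight μ) (hA : A1Bound μ C) (hα : 0 ≤ α) (hK : K ≠ ∞)
    (hb : LipPointwise μ b α K) (hf : AEStronglyMeasurable f volume) :
    ∀ᵐ x, ∀ (c : Fin n → ℝ) (r : ℝ), 0 < r → x ∈ closedBall c r →
      (volume (closedBall c r))⁻¹ * ∫⁻ y in closedBall c r, ‖b y - b x‖ₑ * ‖f y‖ₑ ≤
        2 * K * C * wt μ x * (wMeasure μ (closedBall c r) ^ α *
          ((wMeasure μ (closedBall c r))⁻¹ *
            ∫⁻ y in closedBall c r, ‖f y‖ₑ ∂(wMeasure μ))) := by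
  filter_upwards [hA, hb] with x hxA hxb c r hr hxB
  have hv0 := (volume_closedBall_pos c hr).ne'
  have hvt := (volume_closedBall_lt_top c r).ne
  have hm0 := (hw.wMeasure_closedBall_pos c hr).ne'
  have hmt := (hw.wMeasure_closedBall_lt_top c r).ne
  have h1 := hxA c r hr hxB
  have hI := hA.setLIntegral_le hw (fun y => ‖f y‖ₑ) c hr
  set v := volume (closedBall c r)
  set m := wMeasure μ (closedBall c r)
  set I := ∫⁻ y in closedBall c r, ‖f y‖ₑ ∂(wMeasure μ) with hIdef
  have hvm : v⁻¹ ≤ C * wt μ x * m⁻¹ := by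
    rw [← div_eq_mul_inv, ENNReal.le_div_iff_mul_le (Or.inl hm0) (Or.inl hmt), mul_comm,
      ← div_eq_mul_inv, ENNReal.div_le_iff hv0 hvt]
    exact h1
  have hmα : m ^ α ≠ ∞ := ENNReal.rpow_ne_top_of_nonneg hα hmt
  have hwx : wt μ x ≠ ∞ := (wt_lt_top x).ne
  have hint : ∫⁻ y in closedBall c r, ‖b y - b x‖ₑ * ‖f y‖ₑ ≤
      K * m ^ α * (I + wt μ x * ∫⁻ y in closedBall c r, ‖f y‖ₑ) := by
    have hmeas : AEMeasurable (fun y => ‖f y‖ₑ * wt μ y) (volume.restrict (closedBall c r)) :=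
      (hf.enorm.mul hw.aemeasurable_wt).restrict
    rw [hIdef, hw.setLIntegral_wMeasure, ← lintegral_const_mul' _ _ hwx,
      ← lintegral_add_left' hmeas, ← lintegral_const_mul' _ _ (by finiteness)]
    refine setLIntegral_mono_ae' measurableSet_closedBall ?_
    filter_upwards [hb] with y hy hyB
    have h2 : ‖b y - b x‖ₑ ≤ K * wt μ y * m ^ α + K * wt μ x * m ^ α := by
      rw [← sub_add_sub_cancel (b y) (⨍ z in closedBall c r, b z) (b x)]
      refine (enorm_add_le _ _).trans (add_le_add (hy c r hr hyB) ?_)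
      rw [← enorm_neg, neg_sub]
      exact hxb c r hr hxB
    calc ‖b y - b x‖ₑ * ‖f y‖ₑ ≤ (K * wt μ y * m ^ α + K * wt μ x * m ^ α) * ‖f y‖ₑ := by gcongr
      _ = _ := by ring
  calc _ ≤ v⁻¹ * (K * m ^ α * (I + wt μ x * (C * v * (m⁻¹ * I)))) := by gcongr; exact hint.trans (by gcongr)
    _ = K * m ^ α * (v⁻¹ * I + (v⁻¹ * v) * (wt μ x * C * (m⁻¹ * I))) := by ring
    _ ≤ K * m ^ α * ((C * wt μ x * m⁻¹) * I + 1 * (wt μ x * C * (m⁻¹ * I))) := by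
        rw [ENNReal.inv_mul_cancel hv0 hvt]
        gcongr
    _ = _ := by ring

lemma integrableOn_closedBall_of_morrey (hw : IsWeight μ) (hA : A1Bound μ C) {p κ : ℝ} (hp : 1 < p)
    (hκ0 : 0 < κ) (hf : AEStronglyMeasurable f volume) {N : ℝ≥0∞} (hN : N ≠ ∞)
    (hM : MorreyBound (wMeasure μ) p κ (fun x => ‖f x‖ₑ) N) (c : Fin n → ℝ) {r : ℝ} (hr : 0 < r) :
    (wMeasure μ (closedBall c r))⁻¹ * ∫⁻ y in closedBall c r, ‖f y‖ₑ ∂(wMeasure μ) < ∞ ∧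
      IntegrableOn f (closedBall c r) := by
  have hp0 : 0 < p := by linarith
  have hvt := (volume_closedBall_lt_top c r).ne
  have hm0 := (hw.wMeasure_closedBall_pos c hr).ne'
  have hmt := (hw.wMeasure_closedBall_lt_top c r).ne
  have h1 : (wMeasure μ (closedBall c r))⁻¹ *
      ∫⁻ y in closedBall c r, ‖f y‖ₑ ∂(wMeasure μ) < ∞ := by
    refine (setLIntegral_mean_le_rpow hm0 hmt
      (hf.enorm.mono_ac wMeasure_absolutelyContinuous) hp).trans_lt ?_
    refine ENNReal.rpow_lt_top_of_nonneg (by positivity) ?_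
    refine ENNReal.mul_ne_top (ENNReal.inv_ne_top.2 hm0) (ne_top_of_le_ne_top ?_ (hM c r hr))
    exact ENNReal.mul_ne_top (ENNReal.rpow_ne_top_of_nonneg hp0.le hN)
      (ENNReal.rpow_ne_top_of_nonneg hκ0.le hmt)
  refine ⟨h1, hf.restrict, (hA.setLIntegral_le hw (fun y => ‖f y‖ₑ) c hr).trans_lt ?_⟩
  exact ENNReal.mul_lt_top (by finiteness) h1

lemma locallyIntegrable_of_closedBall {g : (Fin n → ℝ) → ℝ}
    (h : ∀ (c : Fin n → ℝ) (r : ℝ), 0 < r → IntegrableOn g (closedBall c r)) :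
    LocallyIntegrable g volume :=
  fun x => ⟨closedBall x 1, closedBall_mem_nhds x one_pos, h x 1 one_pos⟩

/-- One good point `x` of the cube suffices, through `b f = (b - b(x)) f + b(x) f`. -/
lemma LipPointwise.integrableOn_mul (hw : IsWeight μ) (hA : A1Bound μ C) (hα : 0 ≤ α) (hK : K ≠ ∞)
    (hb : LipPointwise μ b α K) (hbm : AEStronglyMeasurable b volume) {p κ : ℝ} (hp : 1 < p)
    (hκ0 : 0 < κ) (hf : AEStronglyMeasurable f volume) {N : ℝ≥0∞} (hN : N ≠ ∞)
    (hM : MorreyBound (wMeasure μ) p κ (fun x => ‖f x‖ₑ) N) (c : Fin n → ℝ) {r : ℝ} (hr : 0 < r) :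
    IntegrableOn (fun y => b y * f y) (closedBall c r) := by
  obtain ⟨h1, h2⟩ := integrableOn_closedBall_of_morrey hw hA hp hκ0 hf hN hM c hr
  have hv0 := (volume_closedBall_pos c hr).ne'
  have hvt := (volume_closedBall_lt_top c r).ne
  have hmt := (hw.wMeasure_closedBall_lt_top c r).ne
  obtain ⟨x, hxB, hx⟩ : ∃ x ∈ closedBall c r, (volume (closedBall c r))⁻¹ *
      ∫⁻ y in closedBall c r, ‖b y - b x‖ₑ * ‖f y‖ₑ < ∞ := by
    have h3 := hb.average_mul_le hw hA hα hK hf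
    have h4 : ∃ᵐ x, x ∈ closedBall c r := by
      rw [frequently_ae_mem_iff]; exact hv0
    obtain ⟨x, hxB, hx⟩ := (h4.and_eventually h3).exists
    refine ⟨x, hxB, (hx c r hr hxB).trans_lt ?_⟩
    have := (wt_lt_top (μ := μ) x).ne
    have := ENNReal.rpow_ne_top_of_nonneg hα hmt
    exact ENNReal.mul_lt_top (by finiteness) (ENNReal.mul_lt_top (by finiteness) h1)
  have h5 : ∫⁻ y in closedBall c r, ‖b y - b x‖ₑ * ‖f y‖ₑ < ∞ := by
    by_contra h
    rw [not_lt, top_le_iff] at h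
    rw [h, ENNReal.mul_top (ENNReal.inv_ne_zero.2 hvt)] at hx
    exact lt_irrefl _ hx
  have h6 : IntegrableOn (fun y => (b y - b x) * f y) (closedBall c r) := by
    refine ⟨((hbm.sub aestronglyMeasurable_const).mul hf).restrict, ?_⟩
    simpa only [HasFiniteIntegral, enorm_mul] using h5
  refine (h6.add (h2.const_mul (b x))).congr (Eventually.of_forall fun y => ?_)
  simp only [Pi.add_apply]
  ring

lemma sharpMax_const_mul (a : ℝ) (g : (Fin n → ℝ) → ℝ) (x : Fin n → ℝ) :
    sharpMax (fun y => a * g y) x = ‖a‖ₑ * sharpMax g x := by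
  simp only [sharpMax, ENNReal.mul_iSup]
  refine iSup_congr fun Q => iSup_congr fun _ => iSup_congr fun _ => ?_
  exact meanOsc_const_mul (P := avgMeasure Q) a g

lemma sharpMax_le_add {g h : (Fin n → ℝ) → ℝ} {x : Fin n → ℝ} {G : ℝ≥0∞}
    (hg : LocallyIntegrable g volume) (hh : LocallyIntegrable h volume)
    (hG : ∀ (c : Fin n → ℝ) (r : ℝ), 0 < r → x ∈ closedBall c r →
      (volume (closedBall c r))⁻¹ * ∫⁻ y in closedBall c r, ‖g y - h y‖ₑ ≤ G) :
    sharpMax g x ≤ sharpMax h x + 2 * G := by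
  refine sharpMax_le fun c r hr hx => ?_
  have := isProbabilityMeasure_avgMeasure c hr
  have hB := isCompact_closedBall c r
  refine (meanOsc_le_add (integrable_avgMeasure hr (hg.integrableOn_isCompact hB))
    (integrable_avgMeasure hr (hh.integrableOn_isCompact hB))).trans ?_
  rw [lintegral_avgMeasure]
  gcongr
  · exact meanOsc_le_sharpMax h hr hx
  · exact hG c r hr hx

lemma sharpMax_le_two_mul {g : (Fin n → ℝ) → ℝ} {x : Fin n → ℝ} {G : ℝ≥0∞}
    (hg : LocallyIntegrable g volume)
    (hG : ∀ (c : Fin n → ℝ) (r : ℝ), 0 < r → x ∈ closedBall c r →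
      (volume (closedBall c r))⁻¹ * ∫⁻ y in closedBall c r, ‖g y‖ₑ ≤ G) :
    sharpMax g x ≤ 2 * G := by
  refine sharpMax_le fun c r hr hx => ?_
  have := isProbabilityMeasure_avgMeasure c hr
  refine (meanOsc_le_two_mul (integrable_avgMeasure hr
    (hg.integrableOn_isCompact (isCompact_closedBall c r)))).trans ?_
  rw [lintegral_avgMeasure]
  gcongr
  exact hG c r hr hx

lemma A1Bound.sharpMax_le_fracMax (hw : IsWeight μ) (hA : A1Bound μ C)
    (hf : LocallyIntegrable f volume) (x : Fin n → ℝ) :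
    sharpMax f x ≤ 2 * (C * fracMax (wMeasure μ) 0 (fun y => ‖f y‖ₑ) x) := by
  refine sharpMax_le_two_mul hf fun c r hr hx => ?_
  have hv0 := (volume_closedBall_pos c hr).ne'
  have hvt := (volume_closedBall_lt_top c r).ne
  have h1 := le_fracMax (ν := wMeasure μ) (α := 0) (f := fun y => ‖f y‖ₑ) hr hx
  rw [ENNReal.rpow_zero, one_mul] at h1
  calc _ ≤ (volume (closedBall c r))⁻¹ * (C * volume (closedBall c r) *
        fracMax (wMeasure μ) 0 (fun y => ‖f y‖ₑ) x) := by
        gcongr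
        exact (hA.setLIntegral_le hw _ c hr).trans (by gcongr)
    _ = ((volume (closedBall c r))⁻¹ * volume (closedBall c r)) *
          (C * fracMax (wMeasure μ) 0 (fun y => ‖f y‖ₑ) x) := by ring
    _ = _ := by rw [ENNReal.inv_mul_cancel hv0 hvt, one_mul]

/-- Nonnegativity of `b` enters here: it makes `b(x) M^♯ f(x)` equal to `M^♯` of the function `b(x)
f`, which differs from `b f` by a function with controlled averages. -/
lemma LipPointwise.ae_sharpMax_comparison (hw : IsWeight μ) (hA : A1Bound μ C) (hα : 0 ≤ α)
    (hK : K ≠ ∞) (hb : LipPointwise μ b α K) (hb0 : ∀ᵐ x, 0 ≤ b x)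
    (hf : LocallyIntegrable f volume) (hbf : LocallyIntegrable (fun y => b y * f y) volume) :
    ∀ᵐ x, sharpMax (fun y => b y * f y) x ≤ ENNReal.ofReal (b x) * sharpMax f x +
        2 * (2 * K * C * wt μ x * fracMax (wMeasure μ) α (fun y => ‖f y‖ₑ) x) ∧
      ENNReal.ofReal (b x) * sharpMax f x ≤ sharpMax (fun y => b y * f y) x +
        2 * (2 * K * C * wt μ x * fracMax (wMeasure μ) α (fun y => ‖f y‖ₑ) x) := by
  filter_upwards [hb.average_mul_le hw hA hα hK hf.aestronglyMeasurable, hb0] with x hx hx0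
  have hcf : LocallyIntegrable (fun y => b x * f y) volume := hf.smul (b x)
  have hG : ∀ (c : Fin n → ℝ) (r : ℝ), 0 < r → x ∈ closedBall c r →
      (volume (closedBall c r))⁻¹ * ∫⁻ y in closedBall c r, ‖b y * f y - b x * f y‖ₑ ≤
        2 * K * C * wt μ x * fracMax (wMeasure μ) α (fun y => ‖f y‖ₑ) x := by
    intro c r hr hxB
    simp_rw [← sub_mul, enorm_mul]
    refine (hx c r hr hxB).trans ?_
    gcongr
    exact le_fracMax (f := fun y => ‖f y‖ₑ) hr hxB
  rw [← Real.enorm_of_nonneg hx0, ← sharpMax_const_mul]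
  refine ⟨sharpMax_le_add hbf hcf hG, sharpMax_le_add hcf hbf fun c r hr hxB => ?_⟩
  refine le_trans (le_of_eq ?_) (hG c r hr hxB)
  congr 1
  refine lintegral_congr fun y => ?_
  rw [← enorm_neg, neg_sub]

lemma enorm_toReal_sub_le {a a' G : ℝ≥0∞} (ha : a ≠ ∞) (ha' : a' ≠ ∞) (h1 : a ≤ a' + G)
    (h2 : a' ≤ a + G) : ‖a.toReal - a'.toReal‖ₑ ≤ G := by
  by_cases hG : G = ∞
  · rw [hG]; exact le_top
  rw [Real.enorm_eq_ofReal_abs]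
  refine ENNReal.ofReal_le_of_le_toReal (abs_le.2 ?_)
  have h3 := ENNReal.toReal_mono (by finiteness) h1
  have h4 := ENNReal.toReal_mono (by finiteness) h2
  rw [ENNReal.toReal_add ha' hG] at h3
  rw [ENNReal.toReal_add ha hG] at h4
  constructor <;> linarith

lemma measurable_sharpComm (hbm : AEStronglyMeasurable b volume)
    (hf : LocallyIntegrable f volume) (hbf : LocallyIntegrable (fun y => b y * f y) volume) :
    AEStronglyMeasurable (sharpComm b f) volume :=
  (hbm.mul (measurable_sharpMax hf).ennreal_toReal.aestronglyMeasurable).sub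
    (measurable_sharpMax hbf).ennreal_toReal.aestronglyMeasurable

/-- A nonnegative weighted Lipschitz function has a bounded commutator with the sharp maximal
function on weighted Morrey spaces. -/
theorem LipPointwise.sharpCommBounded (hw : IsWeight μ) (hA : A1Bound μ C) {p q κ : ℝ}
    (hp : 1 < p) (hκ0 : 0 < κ) (hκ1 : κ < 1) (hα0 : 0 < α) (hα : α < (1 - κ) / p)
    (hq : 1 / q = 1 / p - α) (hq0 : 0 < q) (hK : K ≠ ∞)
    (hbm : AEStronglyMeasurable b volume) (hb : LipPointwise μ b α K) (hb0 : ∀ᵐ x, 0 ≤ b x) :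
    SharpCommBounded b p κ μ μ q (κ * q / p) (fun x => μ x ^ (1 - q)) μ := by
  have hp0 : 0 < p := by linarith
  obtain ⟨K', hK', hfrac⟩ := exists_fracMax_morrey hw hA hp hκ0 hκ1 hα0 hα hq hq0
  set A : ℝ≥0∞ := 4 * K * C with hAdef
  have hAt : A ≠ ∞ := by finiteness
  have hKq : K' ^ (1 / q) ≠ ∞ := ENNReal.rpow_ne_top_of_nonneg (by positivity) hK'
  have hct : A * K' ^ (1 / q) ≠ ∞ := by finiteness
  refine ⟨(A * K' ^ (1 / q)).toNNReal, fun f hf => ?_⟩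
  rw [ENNReal.coe_toNNReal hct]
  have hfm := hf.aestronglyMeasurable
  have hN := hf.norm_lt_top.ne
  have hM := hw.morreyBound_of_le hp0 (le_refl (morreyNorm p κ μ μ f))
  have hfl : LocallyIntegrable f volume := locallyIntegrable_of_closedBall fun c r hr =>
    (integrableOn_closedBall_of_morrey hw hA hp hκ0 hfm hN hM c hr).2
  have hbfl : LocallyIntegrable (fun y => b y * f y) volume :=
    locallyIntegrable_of_closedBall fun c r hr =>
      hb.integrableOn_mul hw hA hα0.le hK hbm hp hκ0 hfm hN hM c hr
  have hcmp := hb.ae_sharpMax_comparison hw hA hα0.le hK hb0 hfl hbfl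
  have hfin0 : ∀ᵐ x, sharpMax f x < ∞ := by
    filter_upwards [ae_fracMax_lt_top hw hA hp hκ0 hκ1 le_rfl (hα0.trans hα) hfm.enorm hN hM]
      with x hx
    exact (hA.sharpMax_le_fracMax hw hfl x).trans_lt (by finiteness)
  have hfinα := ae_fracMax_lt_top hw hA hp hκ0 hκ1 hα0.le hα hfm.enorm hN hM
  have hfin1 : ∀ᵐ x, sharpMax (fun y => b y * f y) x < ∞ := by
    filter_upwards [hfin0, hfinα, hcmp] with x hx0 hx1 hx2
    have := wt_lt_top (μ := μ) x
    exact hx2.1.trans_lt (by finiteness)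
  have hpt : ∀ᵐ x, ‖sharpComm b f x‖ₑ ≤
      A * (wt μ x * fracMax (wMeasure μ) α (fun y => ‖f y‖ₑ) x) := by
    filter_upwards [hfin0, hfin1, hcmp, hb0] with x hx0 hx1 hx2 hxb
    have h1 : sharpComm b f x = (ENNReal.ofReal (b x) * sharpMax f x).toReal -
        (sharpMax (fun y => b y * f y) x).toReal := by
      rw [sharpComm, ENNReal.toReal_mul, ENNReal.toReal_ofReal hxb]
    rw [h1]
    refine (enorm_toReal_sub_le (by finiteness) hx1.ne hx2.2 hx2.1).trans (le_of_eq ?_)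
    rw [hAdef]
    ring
  clear_value A
  have hbound : ∀ N : ℝ≥0∞, N ≠ 0 → N ≠ ∞ → morreyNorm p κ μ μ f ≤ N →
      morreyNorm q (κ * q / p) (fun x => μ x ^ (1 - q)) μ (sharpComm b f) ≤
        A * K' ^ (1 / q) * N := by
    intro N hN0 hNt hle
    rw [hw.morreyNorm_le_iff hq0]
    intro c r hr
    have hAq : A ^ q ≠ ∞ := ENNReal.rpow_ne_top_of_nonneg hq0.le hAt
    calc ∫⁻ x in closedBall c r, ‖sharpComm b f x‖ₑ ^ q * ENNReal.ofReal (μ x ^ (1 - q))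
        ≤ ∫⁻ x in closedBall c r, A ^ q *
            (fracMax (wMeasure μ) α (fun y => ‖f y‖ₑ) x ^ q * wt μ x) := by
          refine setLIntegral_mono_ae' measurableSet_closedBall ?_
          filter_upwards [hpt, hw.pos_ae] with x hx hxμ _
          -- This cancellation is why the target space carries the weight `μ^(1-q)`.
          have h1 : wt μ x ^ q * ENNReal.ofReal (μ x ^ (1 - q)) = wt μ x := by
            rw [wt, ← ENNReal.ofReal_rpow_of_pos hxμ, ← ENNReal.rpow_add _ _
              (ENNReal.ofReal_pos.2 hxμ).ne' ENNReal.ofReal_ne_top, add_sub_cancel,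
              ENNReal.rpow_one]
          calc _ ≤ (A * (wt μ x * fracMax (wMeasure μ) α (fun y => ‖f y‖ₑ) x)) ^ q *
                ENNReal.ofReal (μ x ^ (1 - q)) := by gcongr
            _ = A ^ q * (fracMax (wMeasure μ) α (fun y => ‖f y‖ₑ) x ^ q *
                  (wt μ x ^ q * ENNReal.ofReal (μ x ^ (1 - q)))) := by
                rw [ENNReal.mul_rpow_of_nonneg _ _ hq0.le, ENNReal.mul_rpow_of_nonneg _ _ hq0.le]
                ring
            _ = _ := by rw [h1]
      _ = A ^ q * ∫⁻ x in closedBall c r,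
            fracMax (wMeasure μ) α (fun y => ‖f y‖ₑ) x ^ q ∂(wMeasure μ) := by
          rw [lintegral_const_mul' _ _ hAq, hw.setLIntegral_wMeasure]
      _ ≤ A ^ q * (K' * N ^ q * wMeasure μ (closedBall c r) ^ (κ * q / p)) := by
          gcongr
          exact hfrac _ N hfm.enorm hN0 hNt (hw.morreyBound_of_le hp0 hle) c r hr
      _ = _ := by
          rw [ENNReal.mul_rpow_of_nonneg _ _ hq0.le, ENNReal.mul_rpow_of_nonneg _ _ hq0.le,
            ← ENNReal.rpow_mul, one_div_mul_cancel hq0.ne', ENNReal.rpow_one]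
          ring
  have hnorm : morreyNorm q (κ * q / p) (fun x => μ x ^ (1 - q)) μ (sharpComm b f) ≤
      A * K' ^ (1 / q) * morreyNorm p κ μ μ f := by
    -- Letting `N` decrease to the norm also covers norm zero, which `hbound` excludes.
    have hlim : Tendsto (fun N => A * K' ^ (1 / q) * N) (𝓝[>] (morreyNorm p κ μ μ f))
        (𝓝 (A * K' ^ (1 / q) * morreyNorm p κ μ μ f)) :=
      ((ENNReal.continuous_const_mul hct).tendsto _).mono_left nhdsWithin_le_nhds
    have : (𝓝[>] (morreyNorm p κ μ μ f)).NeBot := nhdsGT_neBot_of_exists_gt ⟨∞, hf.norm_lt_top⟩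
    refine ge_of_tendsto hlim ?_
    filter_upwards [Ioo_mem_nhdsGT hf.norm_lt_top] with N hN'
    exact hbound N (pos_of_gt hN'.1).ne' hN'.2.ne hN'.1.le
  refine ⟨⟨hfl, hbfl, hfin0, hfin1⟩, ⟨measurable_sharpComm hbm hfl hbfl, ?_, ?_⟩, hnorm⟩
  · intro S hS
    obtain ⟨r, hr, hSr⟩ := hS.isBounded.subset_closedBall_lt 0 (0 : Fin n → ℝ)
    refine (lintegral_mono_set hSr).trans_lt
      (((hw.morreyNorm_le_iff hq0).1 hnorm 0 r hr).trans_lt ?_)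
    refine ENNReal.mul_lt_top (ENNReal.rpow_lt_top_of_nonneg hq0.le (by finiteness))
      (ENNReal.rpow_lt_top_of_nonneg (by positivity) (hw.wMeasure_closedBall_lt_top 0 r).ne)
  · exact hnorm.trans_lt (by finiteness)

end

section

variable {n : ℕ} {μ b f : (Fin n → ℝ) → ℝ} {C : ℝ≥0} {α : ℝ}

/-! ### Testing the commutator on cubes -/

/-- Cubes of radius at most 1 are handled by the weak type inequality; for larger ones the average
is at most the `L¹` norm divided by the volume of a cube of radius 1. -/
lemma ae_sharpMax_lt_top {g : (Fin n → ℝ) → ℝ} (hg : Integrable g) :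
    ∀ᵐ x, sharpMax g x < ∞ := by
  have hfin : ∫⁻ y, ‖g y‖ₑ < ∞ := hg.hasFiniteIntegral
  have hscale : ∀ (c : Fin n → ℝ) (r : ℝ), 0 < r → volume (closedBall c (4 * r)) ≤
      ENNReal.ofReal (4 ^ n) * volume (closedBall c r) := fun c r hr =>
    (volume_closedBall_scale c c (by norm_num) hr.le).le
  have hnull : ∀ᵐ x, ∀ k : ℕ, x ∉ closedBall (0 : Fin n → ℝ) k ∩
      {x | locMax volume 1 (fun y => ‖g y‖ₑ) x = ∞} := by
    rw [ae_all_iff]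
    intro k
    refine measure_eq_zero_iff_ae_notMem.1 ?_
    have hM : ENNReal.ofReal (4 ^ n) * ∫⁻ y, ‖g y‖ₑ ≠ ∞ := by finiteness
    refine measure_inter_eq_top_eq_zero hM fun t _ => ?_
    refine (weak_type_locMax hscale (fun c r hr => volume_closedBall_pos c hr)
      volume_closedBall_lt_top _ 0 k 1 t).trans ?_
    gcongr
    exact Measure.restrict_le_self
  filter_upwards [hnull] with x hx
  obtain ⟨k, hk⟩ := exists_nat_ge (dist x 0)
  have hloc : locMax volume 1 (fun y => ‖g y‖ₑ) x ≠ ∞ := fun h => hx k ⟨mem_closedBall.2 hk, h⟩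
  have hv0 := (volume_closedBall_pos (0 : Fin n → ℝ) one_pos).ne'
  have hinv : (volume (closedBall (0 : Fin n → ℝ) 1))⁻¹ ≠ ∞ := ENNReal.inv_ne_top.2 hv0
  have key := sharpMax_le_two_mul (x := x) (G := locMax volume 1 (fun y => ‖g y‖ₑ) x +
    (volume (closedBall (0 : Fin n → ℝ) 1))⁻¹ * ∫⁻ y, ‖g y‖ₑ) hg.locallyIntegrable ?_
  · exact key.trans_lt (by finiteness)
  intro c r hr hxB
  rcases le_or_gt r 1 with h | h
  · exact (le_locMax hr h hxB).trans le_self_add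
  · refine le_trans ?_ le_add_self
    have hvol : volume (closedBall (0 : Fin n → ℝ) 1) ≤ volume (closedBall c r) := by
      rw [Real.volume_pi_closedBall _ zero_le_one, Real.volume_pi_closedBall _ hr.le]
      gcongr
    gcongr
    exact Measure.restrict_le_self

/-- Split `μ(Q ∩ Q')` into its powers `1 - κ` and `κ`, bounding one by `μ(Q)` and the other by
`μ(Q')`. -/
lemma indicator_memMorrey (hw : IsWeight μ) {p κ : ℝ} (hp0 : 0 < p) (hκ0 : 0 ≤ κ) (hκ1 : κ ≤ 1)
    (c : Fin n → ℝ) (r : ℝ) :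
    MemMorrey p κ μ μ ((closedBall c r).indicator 1) ∧
      morreyNorm p κ μ μ ((closedBall c r).indicator 1) ≤
        wMeasure μ (closedBall c r) ^ ((1 - κ) / p) := by
  have hmQ : MeasurableSet (closedBall c r) := measurableSet_closedBall
  have hQt := (hw.wMeasure_closedBall_lt_top c r).ne
  have hint : ∀ S : Set (Fin n → ℝ),
      ∫⁻ x in S, ‖(closedBall c r).indicator (1 : (Fin n → ℝ) → ℝ) x‖ₑ ^ p *
        ENNReal.ofReal (μ x) = wMeasure μ (closedBall c r ∩ S) := by
    intro S
    rw [wMeasure_apply, ← Measure.restrict_restrict hmQ, ← lintegral_indicator hmQ]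
    refine lintegral_congr fun x => ?_
    by_cases hx : x ∈ closedBall c r
    · simp [hx, wt]
    · simp [hx, hp0]
  have hnorm : morreyNorm p κ μ μ ((closedBall c r).indicator 1) ≤
      wMeasure μ (closedBall c r) ^ ((1 - κ) / p) := by
    rw [hw.morreyNorm_le_iff hp0]
    intro c' r' hr'
    have hκ' : 0 ≤ 1 - κ := by linarith
    rw [hint, ← ENNReal.rpow_mul, div_mul_cancel₀ _ hp0.ne']
    set m := wMeasure μ (closedBall c r ∩ closedBall c' r')
    calc m = m ^ (1 - κ) * m ^ κ := by
          rw [← ENNReal.rpow_add_of_nonneg _ _ hκ' hκ0, sub_add_cancel, ENNReal.rpow_one]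
      _ ≤ _ := by
          gcongr
          · exact measure_mono Set.inter_subset_left
          · exact measure_mono Set.inter_subset_right
  refine ⟨⟨?_, ?_, ?_⟩, hnorm⟩
  · exact (aestronglyMeasurable_const (b := (1 : ℝ))).indicator hmQ
  · intro S _
    rw [hint]
    exact (measure_mono Set.inter_subset_left).trans_lt hQt.lt_top
  · exact hnorm.trans_lt (ENNReal.rpow_lt_top_of_nonneg (by
      have : 0 ≤ 1 - κ := by linarith
      positivity) hQt)

lemma SharpCommBounded.exists_normalizedSize_le (hw : IsWeight μ) (hn : 1 ≤ n) {β p q κ : ℝ}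
    (hp0 : 0 < p) (hq0 : 0 < q) (hκ0 : 0 ≤ κ) (hκ1 : κ ≤ 1) (hq : 1 / q = 1 / p - β / n)
    (h : SharpCommBounded b p κ μ μ q (κ * q / p) (fun x => μ x ^ (1 - q)) μ) :
    ∃ C : ℝ, 0 < C ∧
        (⨆ (Q : Set (Fin n → ℝ)) (_ : IsCube Q),
          normalizedSize β q μ Q
            (fun x => b x - 2 * (sharpMax (Q.indicator b) x).toReal)) ≤
          ENNReal.ofReal C := by
  obtain ⟨C, hC⟩ := h
  refine ⟨2 * C + 1, by positivity, iSup₂_le fun Q hQ => ?_⟩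
  obtain ⟨c, r, hr, rfl⟩ := isCube_iff.1 hQ
  obtain ⟨hmem, hle⟩ := indicator_memMorrey hw hp0 hκ0 hκ1 c r
  obtain ⟨-, -, hb⟩ := hC _ hmem
  have hQ0 := (hw.wMeasure_closedBall_pos c hr).ne'
  have hQt := (hw.wMeasure_closedBall_lt_top c r).ne
  have h1 := (hw.morreyNorm_le_iff hq0).1 (hb.trans (mul_le_mul_right hle (C : ℝ≥0∞))) c r hr
  set m := wMeasure μ (closedBall c r) with hm
  set f : (Fin n → ℝ) → ℝ := (closedBall c r).indicator 1 with hf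
  have hbf : (fun y => b y * f y) = (closedBall c r).indicator b := by
    ext y
    by_cases hy : y ∈ closedBall c r
    · simp [hf, hy]
    · simp [hf, hy]
  have hpt : ∀ x ∈ closedBall c r,
      b x - 2 * (sharpMax ((closedBall c r).indicator b) x).toReal = 2 * sharpComm b f x := by
    intro x hx
    rw [sharpComm, hbf, hf, toReal_sharpMax_indicator_one hn hr hx]
    ring
  rw [hw.normalizedSize_le_iff hq0 hr]
  have h2q : (2 : ℝ≥0∞) ^ q ≠ ∞ := ENNReal.rpow_ne_top_of_nonneg hq0.le (by norm_num)
  have h2 : ‖(2 : ℝ)‖ₑ = 2 := by simp [Real.enorm_eq_ofReal]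
  -- The powers of `μ(Q)` from the norm of the test function and from the target norm add up to `1/p
  -- = β/n + 1/q`, as the normalization demands.
  have hexp : (1 - κ) / p * q + κ * q / p = (β / n + 1 / q) * q := by
    have : β / n + 1 / q = 1 / p := by linarith
    rw [this]
    ring
  calc (∫⁻ x in closedBall c r, ‖b x - 2 * (sharpMax ((closedBall c r).indicator b) x).toReal‖ₑ ^ q *
          ENNReal.ofReal (μ x ^ (1 - q))) ^ (1 / q)
      = (2 ^ q * ∫⁻ x in closedBall c r, ‖sharpComm b f x‖ₑ ^ q *
          ENNReal.ofReal (μ x ^ (1 - q))) ^ (1 / q) := by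
        rw [← lintegral_const_mul' _ _ h2q]
        congr 1
        refine setLIntegral_congr_fun measurableSet_closedBall fun x hx => ?_
        rw [hpt x hx, enorm_mul, h2, ENNReal.mul_rpow_of_nonneg _ _ hq0.le, mul_assoc]
    _ ≤ (2 ^ q * ((C * m ^ ((1 - κ) / p)) ^ q * m ^ (κ * q / p))) ^ (1 / q) := by gcongr
    _ = ((2 * C * m ^ (β / n + 1 / q)) ^ q) ^ (1 / q) := by
        congr 1
        rw [ENNReal.mul_rpow_of_nonneg _ _ hq0.le, ENNReal.mul_rpow_of_nonneg _ _ hq0.le,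
          ENNReal.mul_rpow_of_nonneg _ _ hq0.le, ← ENNReal.rpow_mul m, ← ENNReal.rpow_mul m,
          ← hexp, ENNReal.rpow_add _ _ hQ0 hQt]
        ring
    _ = 2 * C * m ^ (β / n + 1 / q) := by
        rw [← ENNReal.rpow_mul, mul_one_div_cancel hq0.ne', ENNReal.rpow_one]
    _ ≤ _ := by
        gcongr
        rw [ENNReal.ofReal_add (by positivity) zero_le_one, ENNReal.ofReal_mul (by norm_num),
          ENNReal.ofReal_coe_nnreal]
        simp

/-! ### Necessity -/

/-- Hölder's inequality after writing `1 = μ^((1-q)/q) · μ^(1/q')`; it passes from the `L^q`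
condition to the `L¹` one. -/
lemma setLIntegral_enorm_le_weighted (hw : IsWeight μ) {q : ℝ} (hq : 1 < q)
    {g : (Fin n → ℝ) → ℝ} (hg : AEStronglyMeasurable g volume) (Q : Set (Fin n → ℝ)) :
    ∫⁻ x in Q, ‖g x‖ₑ ≤
      (∫⁻ x in Q, ‖g x‖ₑ ^ q * ENNReal.ofReal (μ x ^ (1 - q))) ^ (1 / q) *
        wMeasure μ Q ^ (1 - 1 / q) := by
  have hq0 : 0 < q := by linarith
  have hpq := Real.HolderConjugate.conjExponent hq
  set q' := q.conjExponent
  have hq'0 : 0 < q' := hpq.symm.pos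
  have hsum : 1 / q' = 1 - 1 / q := by
    have := hpq.inv_add_inv_eq_one
    rw [one_div, one_div]; linarith
  have hμm : AEMeasurable μ volume := hw.locallyIntegrable.aestronglyMeasurable.aemeasurable
  have hu : AEMeasurable (fun x => ‖g x‖ₑ * ENNReal.ofReal (μ x ^ ((1 - q) / q)))
      (volume.restrict Q) := (hg.enorm.mul (hμm.pow_const _).ennreal_ofReal).restrict
  have hv : AEMeasurable (fun x => ENNReal.ofReal (μ x ^ (1 / q'))) (volume.restrict Q) :=
    ((hμm.pow_const _).ennreal_ofReal).restrict
  have h := ENNReal.lintegral_mul_le_Lp_mul_Lq (volume.restrict Q) hpq hu hv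
  have hexp : (1 - q) / q + 1 / q' = 0 := by
    rw [hsum]; field_simp; ring
  calc ∫⁻ x in Q, ‖g x‖ₑ
      = ∫⁻ x in Q, ((fun x => ‖g x‖ₑ * ENNReal.ofReal (μ x ^ ((1 - q) / q))) *
          fun x => ENNReal.ofReal (μ x ^ (1 / q'))) x := by
        refine lintegral_congr_ae (ae_restrict_of_ae ?_)
        filter_upwards [hw.pos_ae] with x hx
        simp only [Pi.mul_apply]
        rw [mul_assoc, ← ENNReal.ofReal_mul (by positivity), ← Real.rpow_add hx, hexp,
          Real.rpow_zero, ENNReal.ofReal_one, mul_one]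
    _ ≤ _ := h
    _ = _ := by
        rw [hsum, wMeasure_apply]
        congr 2
        · refine lintegral_congr_ae (ae_restrict_of_ae ?_)
          filter_upwards [hw.pos_ae] with x hx
          rw [ENNReal.mul_rpow_of_nonneg _ _ hq0.le,
            ENNReal.ofReal_rpow_of_pos (Real.rpow_pos_of_pos hx _), ← Real.rpow_mul hx.le,
            div_mul_cancel₀ _ hq0.ne']
        · refine lintegral_congr_ae (ae_restrict_of_ae ?_)
          filter_upwards [hw.pos_ae] with x hx
          rw [ENNReal.ofReal_rpow_of_pos (Real.rpow_pos_of_pos hx _), ← Real.rpow_mul hx.le,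
            ← hsum, one_div_mul_cancel hq'0.ne', Real.rpow_one, wt]

/-- If `|b_Q| ≤ b - g` on `Q` then `g` controls both the oscillation of `b` on `Q` and the
negativity of `b_Q`. -/
lemma oscillation_and_negativity_le (hb : LocallyIntegrable b volume) {g : (Fin n → ℝ) → ℝ}
    (hg : AEStronglyMeasurable g volume) {c : Fin n → ℝ} {r : ℝ} (hr : 0 < r)
    (hgb : ∀ᵐ x, x ∈ closedBall c r → |⨍ y in closedBall c r, b y| ≤ b x - g x) :
    ∫⁻ x in closedBall c r, ‖b x - ⨍ y in closedBall c r, b y‖ₑ ≤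
        2 * ∫⁻ x in closedBall c r, ‖g x‖ₑ ∧
      ENNReal.ofReal (|⨍ y in closedBall c r, b y| - ⨍ y in closedBall c r, b y) ≤
        (volume (closedBall c r))⁻¹ * ∫⁻ x in closedBall c r, ‖g x‖ₑ := by
  have hv0 := (volume_closedBall_pos c hr).ne'
  have hvt := (volume_closedBall_lt_top c r).ne
  by_cases hfin : ∫⁻ x in closedBall c r, ‖g x‖ₑ = ∞
  · rw [hfin, ENNReal.mul_top (by norm_num), ENNReal.mul_top (ENNReal.inv_ne_zero.2 hvt)]
    exact ⟨le_top, le_top⟩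
  have hgi : IntegrableOn g (closedBall c r) := ⟨hg.restrict, lt_top_iff_ne_top.2 hfin⟩
  have hbi : IntegrableOn b (closedBall c r) :=
    hb.integrableOn_isCompact (isCompact_closedBall c r)
  have hprob := isProbabilityMeasure_avgMeasure c hr
  have hgP := integrable_avgMeasure hr hgi
  have hbP := integrable_avgMeasure hr hbi
  set P := avgMeasure (closedBall c r) with hP
  have ha : ⨍ y in closedBall c r, b y = ∫ y, b y ∂P := rfl
  set a := ⨍ y in closedBall c r, b y with hadef
  have haeP : ∀ᵐ x ∂P, |a| ≤ b x - g x := by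
    refine Measure.ae_smul_measure ?_ _
    rwa [ae_restrict_iff' measurableSet_closedBall]
  have hosc : ∫⁻ x, ‖b x - a‖ₑ ∂P ≤ 2 * ∫⁻ x, ‖g x‖ₑ ∂P := by
    have hba : Integrable (fun x => b x - a) P := hbP.sub (integrable_const a)
    rw [← ofReal_integral_norm_eq_lintegral_enorm hba,
      ← ofReal_integral_norm_eq_lintegral_enorm hgP,
      show (2 : ℝ≥0∞) = ENNReal.ofReal 2 by simp, ← ENNReal.ofReal_mul (by norm_num)]
    apply ENNReal.ofReal_le_ofReal
    have h0 : ∫ x, (b x - a) ∂P = 0 := by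
      rw [integral_sub hbP (integrable_const a), integral_const, probReal_univ, one_smul, ha,
        sub_self]
    -- Since `b - a ≥ g`, the negative part of `b - a` is at most `|g|`; and `b - a` has mean zero.
    calc ∫ x, ‖b x - a‖ ∂P ≤ ∫ x, ((b x - a) + 2 * ‖g x‖) ∂P := by
          refine integral_mono_ae hba.norm (hba.add (hgP.norm.const_mul 2)) ?_
          filter_upwards [haeP] with x hx
          have h1 := le_abs_self a
          have h2 := neg_abs_le (g x)
          simp only [Real.norm_eq_abs]
          have h3 := abs_nonneg (g x)
          rcases abs_cases (b x - a) with h | h <;> linarith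
      _ = 2 * ∫ x, ‖g x‖ ∂P := by
          rw [integral_add hba (hgP.norm.const_mul 2), h0, zero_add, integral_const_mul]
  have hneg : ENNReal.ofReal (|a| - a) ≤ ∫⁻ x, ‖g x‖ₑ ∂P := by
    rw [← ofReal_integral_norm_eq_lintegral_enorm hgP]
    apply ENNReal.ofReal_le_ofReal
    have h1 : ∫ _, |a| ∂P ≤ ∫ x, (b x + ‖g x‖) ∂P := by
      refine integral_mono_ae (integrable_const _) (hbP.add hgP.norm) ?_
      filter_upwards [haeP] with x hx
      have h2 := neg_abs_le (g x)
      simp only [Real.norm_eq_abs]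
      linarith
    rw [integral_const, probReal_univ, one_smul, integral_add hbP hgP.norm, ← ha] at h1
    linarith
  rw [lintegral_avgMeasure] at hneg
  rw [lintegral_avgMeasure, lintegral_avgMeasure] at hosc
  refine ⟨?_, hneg⟩
  rw [← ENNReal.mul_le_mul_iff_right (ENNReal.inv_ne_zero.2 hvt) (ENNReal.inv_ne_top.2 hv0)]
  refine hosc.trans (le_of_eq ?_)
  ring

/-- On cubes shrinking to `x`, `A₁` keeps `μ(Q)/|Q|` below `C μ(x)` while `μ(Q)^α` tends to zero.
The limit is `|b(x)| - b(x) ≤ 0`. -/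
lemma ae_nonneg_of_negativity_le (hA : A1Bound μ C) (hn : 1 ≤ n) (hα : 0 < α)
    (hb : LocallyIntegrable b volume) {M : ℝ≥0∞} (hM : M ≠ ∞) (hw : IsWeight μ)
    (h : ∀ (c : Fin n → ℝ) (r : ℝ), 0 < r →
      ENNReal.ofReal (|⨍ y in closedBall c r, b y| - ⨍ y in closedBall c r, b y) ≤
        (volume (closedBall c r))⁻¹ * (M * wMeasure μ (closedBall c r) ^ (α + 1))) :
    ∀ᵐ x, 0 ≤ b x := by
  filter_upwards [hA, IsUnifLocDoublingMeasure.ae_tendsto_average (μ := volume) hb 1]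
    with x hxA hxL
  set rs : ℕ → ℝ := fun k => 1 / ((k : ℝ) + 1) with hrs
  have hrs0 : ∀ k, 0 < rs k := fun k => by positivity
  have hrst : Tendsto rs atTop (𝓝 0) := tendsto_one_div_add_atTop_nhds_zero_nat
  have hlim := hxL (fun _ => x) rs
    (tendsto_nhdsWithin_iff.2 ⟨hrst, Eventually.of_forall hrs0⟩)
    (Eventually.of_forall fun k => mem_closedBall_self (by rw [one_mul]; exact (hrs0 k).le))
  have hwx : wt μ x ≠ ∞ := (wt_lt_top x).ne
  have hvol : Tendsto (fun k => volume (closedBall x (rs k))) atTop (𝓝 0) := by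
    have h1 : ∀ k, volume (closedBall x (rs k)) = ENNReal.ofReal ((2 * rs k) ^ n) := fun k => by
      rw [Real.volume_pi_closedBall _ (hrs0 k).le, Fintype.card_fin]
    simp_rw [h1]
    have h2 := (ENNReal.continuous_ofReal.tendsto _).comp ((hrst.const_mul 2).pow n)
    rw [mul_zero, zero_pow (by omega), ENNReal.ofReal_zero] at h2
    exact h2
  have hle : ∀ k, ENNReal.ofReal (|⨍ y in closedBall x (rs k), b y| -
      ⨍ y in closedBall x (rs k), b y) ≤
      M * C * wt μ x * (C * wt μ x * volume (closedBall x (rs k))) ^ α := by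
    intro k
    have hv0 := (volume_closedBall_pos x (hrs0 k)).ne'
    have hvt := (volume_closedBall_lt_top x (rs k)).ne
    have hm0 := (hw.wMeasure_closedBall_pos x (hrs0 k)).ne'
    have hmt := (hw.wMeasure_closedBall_lt_top x (rs k)).ne
    have hk := hxA x (rs k) (hrs0 k) (mem_closedBall_self (hrs0 k).le)
    refine (h x (rs k) (hrs0 k)).trans ?_
    set v := volume (closedBall x (rs k))
    set m := wMeasure μ (closedBall x (rs k))
    have hk' : v⁻¹ * m ≤ C * wt μ x := by
      rw [← ENNReal.div_eq_inv_mul, ENNReal.div_le_iff hv0 hvt]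
      exact hk
    calc v⁻¹ * (M * m ^ (α + 1)) = M * (v⁻¹ * m) * m ^ α := by
          rw [ENNReal.rpow_add _ _ hm0 hmt, ENNReal.rpow_one]; ring
      _ ≤ M * (C * wt μ x) * (C * wt μ x * v) ^ α := by gcongr
      _ = _ := by ring
  have hright : Tendsto (fun k => M * C * wt μ x *
      (C * wt μ x * volume (closedBall x (rs k))) ^ α) atTop (𝓝 0) := by
    have h1 : Tendsto (fun k => (C : ℝ≥0∞) * wt μ x * volume (closedBall x (rs k))) atTop
        (𝓝 (C * wt μ x * 0)) := ENNReal.Tendsto.const_mul hvol (Or.inr (by finiteness))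
    have h2 := ((ENNReal.continuous_rpow_const (y := α)).tendsto _).comp h1
    have h3 := ENNReal.Tendsto.const_mul (a := M * C * wt μ x) h2 (Or.inr (by finiteness))
    simpa [ENNReal.zero_rpow_of_pos hα] using h3
  have hleft := (ENNReal.continuous_ofReal.tendsto _).comp (hlim.abs.sub hlim)
  have hfinal := le_of_tendsto_of_tendsto' hleft hright hle
  rw [nonpos_iff_eq_zero, ENNReal.ofReal_eq_zero] at hfinal
  have := abs_nonneg (b x)
  linarith

lemma memLip_and_nonneg_of_normalizedSize_le (hw : IsWeight μ) (hA : A1Bound μ C) (hn : 1 ≤ n)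
    {β q : ℝ} (hβ : 0 < β) (hq : 1 < q) (hb : LocallyIntegrable b volume) {M : ℝ≥0∞} (hM : M ≠ ∞)
    (h : (⨆ (Q : Set (Fin n → ℝ)) (_ : IsCube Q),
      normalizedSize β q μ Q (fun x => b x - 2 * (sharpMax (Q.indicator b) x).toReal)) ≤ M) :
    MemLip β μ b ∧ ∀ᵐ x, 0 ≤ b x := by
  have hq0 : 0 < q := by linarith
  have hn0 : (0 : ℝ) < n := by exact_mod_cast hn
  have key : ∀ (c : Fin n → ℝ) (r : ℝ), 0 < r →
      ∫⁻ x in closedBall c r, ‖b x - ⨍ y in closedBall c r, b y‖ₑ ≤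
        2 * M * wMeasure μ (closedBall c r) ^ (β / n + 1) ∧
      ENNReal.ofReal (|⨍ y in closedBall c r, b y| - ⨍ y in closedBall c r, b y) ≤
        (volume (closedBall c r))⁻¹ * (M * wMeasure μ (closedBall c r) ^ (β / n + 1)) := by
    intro c r hr
    have hQ0 := (hw.wMeasure_closedBall_pos c hr).ne'
    have hQt := (hw.wMeasure_closedBall_lt_top c r).ne
    have h1 := (hw.normalizedSize_le_iff hq0 hr).1
      ((le_iSup₂_of_le (closedBall c r) (isCube_closedBall c hr) le_rfl).trans h)
    have hbi : IntegrableOn b (closedBall c r) :=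
      hb.integrableOn_isCompact (isCompact_closedBall c r)
    have hbind : Integrable ((closedBall c r).indicator b) :=
      (integrable_indicator_iff measurableSet_closedBall).2 hbi
    set g : (Fin n → ℝ) → ℝ :=
      fun x => b x - 2 * (sharpMax ((closedBall c r).indicator b) x).toReal with hg
    have hgm : AEStronglyMeasurable g volume := hb.aestronglyMeasurable.sub
      ((measurable_sharpMax hbind.locallyIntegrable).ennreal_toReal.const_mul 2).aestronglyMeasurable
    have hgint : ∫⁻ x in closedBall c r, ‖g x‖ₑ ≤
        M * wMeasure μ (closedBall c r) ^ (β / n + 1) := by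
      refine (setLIntegral_enorm_le_weighted hw hq hgm _).trans ?_
      calc _ ≤ M * wMeasure μ (closedBall c r) ^ (β / n + 1 / q) *
            wMeasure μ (closedBall c r) ^ (1 - 1 / q) := by gcongr
        _ = _ := by
            rw [mul_assoc, ← ENNReal.rpow_add _ _ hQ0 hQt]
            congr 2
            ring
    have hgb : ∀ᵐ x, x ∈ closedBall c r → |⨍ y in closedBall c r, b y| ≤ b x - g x := by
      -- Finiteness is essential: `toReal` sends `∞` to `0`, which would destroy the lower bound by
      -- `|b_Q|`.
      filter_upwards [ae_sharpMax_lt_top hbind] with x hx hxB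
      have h2 := enorm_average_le_two_mul_sharpMax hn hr hbi hxB
      have h3 := ENNReal.toReal_mono (by finiteness) h2
      rw [ENNReal.toReal_mul, toReal_enorm, Real.norm_eq_abs] at h3
      simp only [hg, sub_sub_cancel]
      exact h3
    obtain ⟨h4, h5⟩ := oscillation_and_negativity_le hb hgm hr hgb
    refine ⟨h4.trans ?_, h5.trans (by gcongr)⟩
    rw [mul_assoc]
    gcongr
  refine ⟨⟨hb, lt_of_le_of_lt (b := 2 * M) (iSup₂_le fun Q hQ => ?_) (by finiteness)⟩,
    ae_nonneg_of_negativity_le hA hn (by positivity) hb hM hw fun c r hr => (key c r hr).2⟩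
  obtain ⟨c, r, hr, rfl⟩ := isCube_iff.1 hQ
  exact (hw.normalizedSize_one_le_iff hr).2 (key c r hr).1

lemma MemLip.exists_lipPointwise (hw : IsWeight μ) (hA : A1Bound μ C) (hC : 0 < C) (hn : 1 ≤ n)
    {β : ℝ} (hβ : 0 < β) (hb : MemLip β μ b) :
    ∃ K : ℝ≥0∞, K ≠ ∞ ∧ LipPointwise μ b (β / n) K := by
  have hn0 : (0 : ℝ) < n := by exact_mod_cast hn
  refine exists_lip_pointwise hw hA hC hn (by positivity) hb.1 hb.2.ne fun c r hr => ?_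
  rw [← hw.normalizedSize_one_le_iff hr]
  exact le_iSup₂_of_le (closedBall c r) (isCube_closedBall c hr) le_rfl

end

end WMorrey

/-! ### Exponent arithmetic and the cycle of implications -/

theorem theorem1p3 (n : ℕ) (b μ : (Fin n → ℝ) → ℝ) (β p q κ : ℝ)
    (hb : LocallyIntegrable b volume) (hμ : WMorrey.IsA1 μ)
    (hβ0 : 0 < β) (hβ1 : β < 1) (hp1 : 1 < p) (hp : p < n / β)
    (hq : 1 / q = 1 / p - β / n) (hκ0 : 0 < κ) (hκ : κ < p / q) :
    List.TFAE [
      WMorrey.MemLip β μ b ∧ ∀ᵐ x, 0 ≤ b x,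
      WMorrey.SharpCommBounded b p κ μ μ q (κ * q / p) (fun x => μ x ^ (1 - q)) μ,
      ∃ C : ℝ, 0 < C ∧
        (⨆ (Q : Set (Fin n → ℝ)) (_ : WMorrey.IsCube Q),
          WMorrey.normalizedSize β q μ Q
            (fun x => b x - 2 * (WMorrey.sharpMax (Q.indicator b) x).toReal)) ≤
          ENNReal.ofReal C] := by
  have hw := hμ.1
  obtain ⟨A, hA0, hA⟩ := hμ.exists_bound
  have hp0 : 0 < p := by linarith
  have hn : 1 ≤ n := by
    -- In dimension zero `n / β = 0`, so the upper bound on `p` contradicts `1 < p`.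
    rcases Nat.eq_zero_or_pos n with rfl | h
    · simp at hp; linarith
    · exact h
  have hn0 : (0 : ℝ) < n := by exact_mod_cast hn
  have hα0 : 0 < β / n := by positivity
  have hα1 : β / n < 1 / p := by
    rw [div_lt_div_iff₀ hn0 hp0]
    rw [lt_div_iff₀ hβ0] at hp
    linarith
  have hq0 : 0 < q := one_div_pos.1 (by linarith)
  have hpq : p < q := (one_div_lt_one_div hq0 hp0).1 (by linarith)
  have hκ1 : κ < 1 := hκ.trans ((div_lt_one hq0).2 hpq)
  -- A restatement of `κ < p / q`: exactly the condition under which large balls contribute a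
  -- negative power of their mass.
  have hα : β / n < (1 - κ) / p := by
    have h1 : κ / p < 1 / q := by
      rw [div_lt_iff₀ hp0, one_div_mul_eq_div]
      exact hκ
    rw [sub_div]
    linarith
  tfae_have 1 → 2 := by
    rintro ⟨hlip, hnonneg⟩
    obtain ⟨K, hK, hpt⟩ := hlip.exists_lipPointwise hw hA hA0 hn hβ0
    exact hpt.sharpCommBounded hw hA hp1 hκ0 hκ1 hα0 hα hq hq0 hK hb.aestronglyMeasurable hnonneg
  tfae_have 2 → 3 := fun h => h.exists_normalizedSize_le hw hn hp0 hq0 hκ0.le hκ1.le hq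
  tfae_have 3 → 1 := by
    rintro ⟨M, -, hM⟩
    exact WMorrey.memLip_and_nonneg_of_normalizedSize_le hw hA hn hβ0 (hp1.trans hpq) hb
      ENNReal.ofReal_ne_top hM
  tfae_finish
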